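/- **Setting.** Let $M\ge 1$, $\sigma_N^2>0$, $R>0$, $\mathcal P>0$, $\mathcal J>0$, and let $\mathfrak m$ be a probability law on $\mathbb R_+^M$ that has a density (the law of the vector $\mathbf h=(h_0,\dots,h_{M-1})$ of squared channel coefficients of a frame). A pure strategy of the transmitter (jammer) is a measurable map $\mathbf h\mapsto (P_m(\mathbf h))_{m<M}\in\mathbb R_+^M$ (respectively $(J_m(\mathbf h))_{m<M}$). Write $P_M(\mathbf h)=\frac1M\sum_m P_m(\mathbf h)$, $J_M(\mathbf h)=\frac1M\sum_m J_m(\mathbf h)$ and $$I_M(\mathbf h,\{P_m\},\{J_m\})=\frac1M\sum_{m=0}^{M-1}\log\Big(1+\frac{h_mP_m}{\sigma_N^2+J_m}\Big).$$ A strategy is admissible if $E[P_M]\le\mathcal P$ (respectively $E[J_M]\le\mathcal J$). For an admissible transmitter strategy $T$ let $\mathrm{Out}(T)=\sup_J \Pr(I_M(\mathbf h,T(\mathbf h),J(\mathbf h))<R)$, the supremum being over admissible jammer strategies $J$, which may depend on $T$. Let $v=\inf_T \mathrm{Out}(T)$ be the minimax value, the infimum being over admissible $T$; an admissible $T$ is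 optimal if $\mathrm{Out}(T)=v$. For a channel vector $\mathbf h$, the jamming power required against a transmitter allocation $\{P_m\}$ is the least $\frac1M\sum_m J_m$ over $\{J_m\ge0\}$ with $I_M(\mathbf h,\{P_m\},\{J_m\})\le R$. The required jamming power $\mathscr J_M(P,\mathbf h)$ at frame power $P$ is the maximum of this quantity over allocations with $\frac1M\sum_mP_m\le P$. The transmitter power required to reach level $K$ is $\mathscr P_M(K,\mathbf h)=\inf\{P\ge 0:\mathscr J_M(P,\mathbf h)\ge K\}$. A transmitter strategy is a *level-$K$ strategy* if there is a threshold $\theta\in[0,\infty]$ such that almost every frame $\mathbf h$ is either used, in which case $P_M(\mathbf h)=\mathscr P_M(K,\mathbf h)\le\theta$ and the blocks get this power in such a way that the required jamming power is exactly $K$; or is left without power, in which case $\mathscr P_M(K,\mathbf h)\ge\theta$. That is, the transmitter raises the required jamming power to $K$, starting with the frames on which the transmitter power required for this is least. Let $P_{out}(K)$ be the infimum of $\mathrm{Out}(T)$ over the admissible level-$K$ strategies $T$. A level $K\ge0$ is optimal if some optimal strategy is a level-$K$ strategy. **Theorem.** 1. If $K>0$ and $T$ is an admissible level-$K$ strategy,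 then $\mathrm{Out}(T)=1-\big(\mathfrak m\{\mathbf h: T(\mathbf h)\neq 0\}-\mathcal J/K\big)^+$. There is a finite $K_{\max}\ge 0$ such that, moreover: 2. For some $0<K\le K_{\max}$ there is a level-$K$ strategy with $E[P_M]=\mathcal P$ that is optimal. 3. If $v<1$ (outage is not certain), every optimal transmitter strategy satisfies $E[P_M]=\mathcal P$ and is a level-$K$ strategy for some $0<K\le K_{\max}$. 4. The optimal level can be found by exhaustive search over $[0,K_{\max}]$: for every $\varepsilon>0$ there is $\delta>0$ such that, for every finite grid $\Gamma\subset[0,K_{\max}]$ that has a point within distance $\delta$ of each point of $[0,K_{\max}]$, every $K\in\Gamma$ that minimizes $P_{out}$ over $\Gamma$ satisfies $P_{out}(K)\le v+\varepsilon$ and lies within $\varepsilon$ of an optimal level in $[0,K_{\max}]$. -/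

import Mathlib

open MeasureTheory
open scoped NNReal ENNReal

namespace SlowFading

noncomputable section

/-- The data of the jamming game on a parallel slow-fading channel with `M` blocks per frame:
the law of the vector of squared channel coefficients, the noise variance, the code rate, and the
long-term (average) power budgets of transmitter and jammer. -/
structure Game (M : ℕ) where
  law : Measure (Fin M → ℝ)
  noise : ℝ
  rate : ℝ
  txBudget : ℝ≥0
  jamBudget : ℝ≥0

/-- A power allocation over the blocks of a single frame. -/
abbrev Alloc (M : ℕ) := Fin M → ℝ≥0

/-- A pure strategy of a player who knows the channel vector. -/
abbrev Strategy (M : ℕ) := (Fin M → ℝ) → Alloc M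

variable {M : ℕ}

/-- The power of a frame, `(1 / M) * ∑ m, x m`. -/
def frameAvg (x : Alloc M) : ℝ≥0 := (∑ m, x m) / (M : ℝ≥0)

namespace Game

/-- Instantaneous mutual information over a frame with channel vector `h`, transmitter
allocation `p` and jammer allocation `j`. -/
def mutualInfo (G : Game M) (h : Fin M → ℝ) (p j : Alloc M) : ℝ :=
  (1 / (M : ℝ)) * ∑ m, Real.log (1 + h m * (p m : ℝ) / (G.noise + (j m : ℝ)))

/-- Expected frame power of a strategy. -/
def avgPower (G : Game M) (T : Strategy M) : ℝ≥0∞ :=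
  ∫⁻ h, (frameAvg (T h) : ℝ≥0∞) ∂G.law

/-- Transmitter strategies that obey the long-term power constraint. -/
def TxAdmissible (G : Game M) (T : Strategy M) : Prop :=
  Measurable T ∧ G.avgPower T ≤ (G.txBudget : ℝ≥0∞)

/-- Jammer strategies that obey the long-term power constraint. -/
def JamAdmissible (G : Game M) (J : Strategy M) : Prop :=
  Measurable J ∧ G.avgPower J ≤ (G.jamBudget : ℝ≥0∞)

/-- Outage probability of a pair of strategies. -/
def outage (G : Game M) (T J : Strategy M) : ℝ≥0∞ :=
  G.law {h | G.mutualInfo h (T h) (J h) < G.rate}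

/-- Outage probability of a transmitter strategy when the jammer, who plays second and knows it,
answers as well as possible. -/
def worstOutage (G : Game M) (T : Strategy M) : ℝ≥0∞ :=
  ⨆ (J : Strategy M) (_ : G.JamAdmissible J), G.outage T J

/-- The minimax (transmitter-first) value of the game. -/
def minimaxValue (G : Game M) : ℝ≥0∞ :=
  ⨅ (T : Strategy M) (_ : G.TxAdmissible T), G.worstOutage T

/-- `T` is an optimal transmitter strategy in the minimax game. -/
def IsMinimaxOptimal (G : Game M) (T : Strategy M) : Prop :=
  G.TxAdmissible T ∧ ∀ T' : Strategy M, G.TxAdmissible T' → G.worstOutage T ≤ G.worstOutage T'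

/-- The least frame power with which the jammer can push the mutual information down to the rate,
against the transmitter allocation `p`. -/
def jamCost (G : Game M) (h : Fin M → ℝ) (p : Alloc M) : ℝ≥0∞ :=
  ⨅ (j : Alloc M) (_ : G.mutualInfo h p j ≤ G.rate), (frameAvg j : ℝ≥0∞)

/-- The required jamming power over a frame in which the transmitter invests frame power `P`,
distributed over the blocks so as to make jamming as expensive as possible. -/
def requiredJam (G : Game M) (P : ℝ≥0) (h : Fin M → ℝ) : ℝ≥0∞ :=
  ⨆ (p : Alloc M) (_ : frameAvg p ≤ P), G.jamCost h p

/-- The least transmitter frame power that raises the required jamming power to the level `K`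
(infinite if no power does). -/
def requiredTx (G : Game M) (K : ℝ≥0) (h : Fin M → ℝ) : ℝ≥0∞ :=
  ⨅ (P : ℝ≥0) (_ : (K : ℝ≥0∞) ≤ G.requiredJam P h), (P : ℝ≥0∞)

/-- `T` raises the required jamming power up to the level `K`, starting with the frames that need
the least transmitter power for it. For some threshold `θ` and almost every `h`, either the frame
is used: it gets exactly the power `requiredTx K h`, distributed so that the required jamming
power is `K`, and `requiredTx K h ≤ θ`; or the frame is left empty and `θ ≤ requiredTx K h`. -/
def IsLevelStrategy (G : Game M) (K : ℝ≥0) (T : Strategy M) : Prop :=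
  ∃ θ : ℝ≥0∞, ∀ᵐ h ∂G.law,
    ((frameAvg (T h) : ℝ≥0∞) = G.requiredTx K h ∧ G.jamCost h (T h) = (K : ℝ≥0∞) ∧
        G.requiredTx K h ≤ θ) ∨
      (T h = 0 ∧ θ ≤ G.requiredTx K h)

/-- The best outage probability that the transmitter can guarantee with level `K`. -/
def levelOutage (G : Game M) (K : ℝ≥0) : ℝ≥0∞ :=
  ⨅ (T : Strategy M) (_ : G.TxAdmissible T) (_ : G.IsLevelStrategy K T), G.worstOutage T

/-- `K` is an optimal level: some minimax-optimal transmitter strategy has level `K`. -/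
def IsOptimalLevel (G : Game M) (K : ℝ≥0) : Prop :=
  ∃ T : Strategy M, G.IsLevelStrategy K T ∧ G.IsMinimaxOptimal T

end Game

end

end SlowFading

open Filter Topology

namespace SlowFading

variable {M : ℕ}

/-! ### Frame averages -/

/-! Every frame has two costs: `jamCost`, the price of ruining it for the jammer, and `requiredTx
K`, the price for the transmitter of lifting `jamCost` to `K`. Both players therefore solve a
fractional knapsack problem (`packValue`) over the channel law. That law has no atoms, so a set of
cheapest frames is a solution (`exists_set_packValue`). In particular `worstOutage T` is the
knapsack value for the costs `jamCost` (`Proper.worstOutage_eq`).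

The driving inequality is superlinearity: multiplying an allocation by `c ≥ 1` multiplies `jamCost`
by at least `c`, and by strictly more if `c > 1` and the cost is positive, because the noise does
not grow along. Hence reaching a fraction of the level `K` costs at least that fraction of
`requiredTx K` (`min_mul_requiredTx_le`).

Let `T` have worst outage below 1, and let `K` be the cost threshold of the jammer's knapsack. In
the integral of `min (jamCost / K) 1` the ruined frames contribute `jamBudget / K` and the others
their measure, so the success probability is this integral minus `jamBudget / K`
(`exists_levelFraction_eq`). The integrand is a feasible selection in the transmitter's knapsack, so
the success probability is at most `gain K = coverage K - jamBudget / K`. A level strategy on the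
cheapest frames attains a nonnegative gain. The minimax success probability, if positive, is thus
the maximum of `gain`, which exists since `gain` is continuous at positive levels, nonpositive for
`K ≤ jamBudget`, and eventually below any given positive number.

An optimal strategy makes the whole chain tight. Equality in the knapsack forces full power and the
cheapest frames, and strict superlinearity excludes partially reached levels. The grid search
follows from continuity of `gain` and compactness. -/

lemma frameAvg_smul (c : ℝ≥0) (x : Alloc M) : frameAvg (c • x) = c * frameAvg x := by
  simp [frameAvg, ← Finset.mul_sum, mul_div_assoc]

lemma frameAvg_add (x y : Alloc M) : frameAvg (x + y) = frameAvg x + frameAvg y := by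
  simp [frameAvg, Finset.sum_add_distrib, add_div]

@[simp] lemma frameAvg_zero : frameAvg (0 : Alloc M) = 0 := by simp [frameAvg]

lemma frameAvg_const (hM : 0 < M) (t : ℝ≥0) : frameAvg (fun _ : Fin M => t) = t := by
  have : (M : ℝ≥0) ≠ 0 := by positivity
  simp [frameAvg, this]

lemma frameAvg_eq_zero (hM : 0 < M) {x : Alloc M} : frameAvg x = 0 ↔ x = 0 := by
  have : (M : ℝ≥0) ≠ 0 := by positivity
  simp [frameAvg, this, funext_iff]

@[fun_prop] lemma continuous_frameAvg : Continuous (frameAvg : Alloc M → ℝ≥0) := by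
  unfold frameAvg
  simp only [div_eq_mul_inv]
  fun_prop

lemma le_mul_frameAvg (hM : 0 < M) (x : Alloc M) (m : Fin M) : x m ≤ M * frameAvg x := by
  have : (M : ℝ≥0) ≠ 0 := by positivity
  rw [frameAvg, mul_div_cancel₀ _ this]
  exact Finset.single_le_sum (f := x) (fun _ _ => zero_le) (Finset.mem_univ m)

lemma isCompact_frameAvg_le (hM : 0 < M) (c : ℝ≥0) : IsCompact {x : Alloc M | frameAvg x ≤ c} := by
  refine IsCompact.of_isClosed_subset (isCompact_Icc (a := (0 : Alloc M)) (b := fun _ => M * c))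
    (isClosed_le continuous_frameAvg continuous_const) fun x hx => ⟨fun _ => zero_le, fun m => ?_⟩
  exact (le_mul_frameAvg hM x m).trans (mul_le_mul_right (α := ℝ≥0) hx _)

namespace Game

variable (G : Game M) {h : Fin M → ℝ}

/-! ### Mutual information -/

@[simp] lemma mutualInfo_zero (j : Alloc M) : G.mutualInfo h 0 j = 0 := by
  simp [mutualInfo]

variable {G}

lemma snr_nonneg (hN : 0 < G.noise) (hh : ∀ m, 0 < h m) (p j : Alloc M) (m : Fin M) :
    0 ≤ h m * (p m : ℝ) / (G.noise + (j m : ℝ)) := by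
  have := hh m
  positivity

lemma continuous_mutualInfo (hN : 0 < G.noise) (hh : ∀ m, 0 < h m) :
    Continuous fun q : Alloc M × Alloc M => G.mutualInfo h q.1 q.2 := by
  unfold mutualInfo
  refine continuous_const.mul (continuous_finsetSum _ fun m _ => ?_)
  have h1 : Continuous fun q : Alloc M × Alloc M => (q.1 m : ℝ) :=
    NNReal.continuous_coe.comp ((continuous_apply m).comp continuous_fst)
  have h2 : Continuous fun q : Alloc M × Alloc M => (q.2 m : ℝ) :=
    NNReal.continuous_coe.comp ((continuous_apply m).comp continuous_snd)
  have h3 : Continuous fun q : Alloc M × Alloc M => h m * (q.1 m : ℝ) / (G.noise + (q.2 m : ℝ)) :=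
    (continuous_const.mul h1).div (continuous_const.add h2) fun q => by positivity
  exact (continuous_const.add h3).log fun q =>
    (add_pos_of_pos_of_nonneg one_pos (snr_nonneg hN hh q.1 q.2 m)).ne'

lemma measurable_mutualInfo (j : Alloc M) :
    Measurable fun q : (Fin M → ℝ) × Alloc M => G.mutualInfo q.1 q.2 j := by
  unfold mutualInfo
  refine measurable_const.mul (Finset.measurable_sum _ fun m _ => Real.measurable_log.comp ?_)
  refine measurable_const.add (Measurable.div_const ?_ _)
  exact ((measurable_pi_apply m).comp measurable_fst).mul
    ((measurable_pi_apply m).comp measurable_snd).coe_nnreal_real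

/-- Outage asks for a strict inequality, `jamCost` for a weak one. An arbitrarily small uniform
addition of jamming power bridges the gap. -/
lemma mutualInfo_add_const_lt (hM : 0 < M) (hN : 0 < G.noise) (hR : 0 < G.rate)
    (hh : ∀ m, 0 < h m) {p j : Alloc M} (hI : G.mutualInfo h p j ≤ G.rate) {t : ℝ≥0} (ht : 0 < t) :
    G.mutualInfo h p (j + fun _ => t) < G.rate := by
  by_cases hp : p = 0
  · simpa [hp] using hR
  obtain ⟨m, hm⟩ : ∃ m, p m ≠ 0 := by
    by_contra! hc
    exact hp (funext hc)
  refine lt_of_lt_of_le ?_ hI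
  unfold mutualInfo
  refine mul_lt_mul_of_pos_left (Finset.sum_lt_sum (fun i _ => ?_) ⟨m, Finset.mem_univ m, ?_⟩)
    (by positivity)
  · have := snr_nonneg hN hh p (j + fun _ => t) i
    have := hh i
    refine Real.log_le_log (by positivity) ?_
    gcongr
    simp
  · have := snr_nonneg hN hh p (j + fun _ => t) m
    have h1 := hh m
    have h2 : 0 < p m := pos_of_ne_zero hm
    refine Real.log_lt_log (by positivity) ?_
    gcongr
    simpa using ht

lemma log_midpoint_le {a b : ℝ} (ha : 0 ≤ a) (hb : 0 ≤ b) :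
    (Real.log (1 + a) + Real.log (1 + b)) / 2 ≤ Real.log (1 + (a + b) / 2) := by
  have := strictConcaveOn_log_Ioi.concaveOn.2 (show 0 < 1 + a by positivity)
    (show 0 < 1 + b by positivity) (show (0 : ℝ) ≤ 1 / 2 by norm_num)
    (show (0 : ℝ) ≤ 1 / 2 by norm_num) (by norm_num)
  simp only [smul_eq_mul] at this
  rw [show 1 / 2 * (1 + a) + 1 / 2 * (1 + b) = 1 + (a + b) / 2 by ring] at this
  linarith

lemma log_midpoint_lt {a b : ℝ} (ha : 0 ≤ a) (hb : 0 ≤ b) (hab : a ≠ b) :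
    (Real.log (1 + a) + Real.log (1 + b)) / 2 < Real.log (1 + (a + b) / 2) := by
  have := strictConcaveOn_log_Ioi.2 (show 0 < 1 + a by positivity)
    (show 0 < 1 + b by positivity) (by simpa using hab) (show (0 : ℝ) < 1 / 2 by norm_num)
    (show (0 : ℝ) < 1 / 2 by norm_num) (by norm_num)
  simp only [smul_eq_mul] at this
  rw [show 1 / 2 * (1 + a) + 1 / 2 * (1 + b) = 1 + (a + b) / 2 by ring] at this
  linarith

/-- Strict concavity of the logarithm on a block where the allocations differ. It is the source of
uniqueness of level allocations. -/
lemma lt_mutualInfo_midpoint (hM : 0 < M) (hN : 0 < G.noise) (hh : ∀ m, 0 < h m)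
    {p p' j : Alloc M} (hp : p ≠ p') {r : ℝ} (h1 : r ≤ G.mutualInfo h p j)
    (h2 : r ≤ G.mutualInfo h p' j) : r < G.mutualInfo h ((2 : ℝ≥0)⁻¹ • (p + p')) j := by
  obtain ⟨m, hm⟩ : ∃ m, p m ≠ p' m := by
    by_contra! hc
    exact hp (funext hc)
  suffices (G.mutualInfo h p j + G.mutualInfo h p' j) / 2 <
      G.mutualInfo h ((2 : ℝ≥0)⁻¹ • (p + p')) j by linarith
  have key : ∀ i, h i * (((2 : ℝ≥0)⁻¹ • (p + p')) i : ℝ) / (G.noise + (j i : ℝ)) =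
      (h i * (p i : ℝ) / (G.noise + (j i : ℝ)) + h i * (p' i : ℝ) / (G.noise + (j i : ℝ))) / 2 := by
    intro i
    simp only [Pi.smul_apply, Pi.add_apply, smul_eq_mul, NNReal.coe_mul, NNReal.coe_inv,
      NNReal.coe_ofNat, NNReal.coe_add]
    ring
  unfold mutualInfo
  rw [← mul_add, ← Finset.sum_add_distrib, mul_div_assoc, Finset.sum_div]
  refine mul_lt_mul_of_pos_left (Finset.sum_lt_sum (fun i _ => ?_) ⟨m, Finset.mem_univ m, ?_⟩)
    (by positivity)
  · rw [key]
    exact log_midpoint_le (snr_nonneg hN hh p j i) (snr_nonneg hN hh p' j i)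
  · rw [key]
    refine log_midpoint_lt (snr_nonneg hN hh p j m) (snr_nonneg hN hh p' j m) ?_
    have hNj : (G.noise + (j m : ℝ)) ≠ 0 := by positivity
    rw [Ne, div_left_inj' hNj, mul_right_inj' (hh m).ne']
    exact_mod_cast hm

/-- Jamming power that counters a transmitter allocation, if divided by `c` after the removal of
`(c - 1)` times the noise power, counters the allocation divided by `c`. -/
lemma mutualInfo_le_smul (hN : 0 < G.noise) (hh : ∀ m, 0 < h m) (p j : Alloc M) {c : ℝ≥0}
    (hc : 1 ≤ c) :
    G.mutualInfo h p (c⁻¹ • (j - fun _ => (c - 1) * G.noise.toNNReal)) ≤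
      G.mutualInfo h (c • p) j := by
  have hc' : (1 : ℝ) ≤ c := by exact_mod_cast hc
  unfold mutualInfo
  refine mul_le_mul_of_nonneg_left (Finset.sum_le_sum fun m _ => ?_) (by positivity)
  refine Real.log_le_log ?_ (add_le_add_right ?_ 1)
  · have := snr_nonneg hN hh p (c⁻¹ • (j - fun _ => (c - 1) * G.noise.toNNReal)) m
    positivity
  · have hm := hh m
    have e : h m * (((c • p) m : ℝ≥0) : ℝ) / (G.noise + j m) =
        h m * p m / ((G.noise + j m) / c) := by
      simp only [Pi.smul_apply, smul_eq_mul, NNReal.coe_mul]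
      field_simp
    rw [e]
    refine div_le_div_of_nonneg_left (by positivity) (by positivity) ?_
    rw [div_le_iff₀ (by positivity)]
    simp only [Pi.smul_apply, Pi.sub_apply, smul_eq_mul, NNReal.coe_mul, NNReal.coe_inv]
    -- Truncated subtraction can only leave more jamming power, which is harmless in this direction.
    have h1 : ((j m : ℝ) - (c - 1) * G.noise) ≤
        ((j m - (c - 1) * G.noise.toNNReal : ℝ≥0) : ℝ) := by
      rw [NNReal.coe_sub_def]
      refine (le_of_eq ?_).trans (le_max_left _ _)
      rw [NNReal.coe_mul, NNReal.coe_sub hc, Real.coe_toNNReal _ hN.le]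
      simp
    rw [add_mul, mul_comm (c : ℝ)⁻¹, mul_assoc, inv_mul_cancel₀ (by positivity)]
    linarith

lemma mutualInfo_const_le (hM : 0 < M) (hN : 0 < G.noise) (hh : ∀ m, 0 < h m) (p : Alloc M)
    {t : ℝ≥0} (ht : 0 < t) :
    G.mutualInfo h p (fun _ => t) ≤ (∑ m, h m) * frameAvg p / t := by
  have hS : ∀ m, h m ≤ ∑ m, h m := fun m =>
    Finset.single_le_sum (f := h) (fun i _ => (hh i).le) (Finset.mem_univ m)
  have : ∀ m, Real.log (1 + h m * (p m : ℝ) / (G.noise + ((fun _ => t : Alloc M) m : ℝ))) ≤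
      (∑ m, h m) * p m / t := by
    intro m
    have h0 := snr_nonneg hN hh p (fun _ => t) m
    refine (Real.log_le_sub_one_of_pos (by positivity)).trans ?_
    rw [add_sub_cancel_left]
    have := hh m
    have := hS m
    have hS0 : 0 ≤ ∑ m, h m := this.trans' (hh m).le
    refine div_le_div₀ (by positivity) (by gcongr) (by exact_mod_cast ht) (by linarith)
  calc G.mutualInfo h p (fun _ => t) ≤ (1 / (M : ℝ)) * ∑ m, (∑ m, h m) * p m / t := by
        unfold mutualInfo
        gcongr with m
        exact this m
    _ = _ := by
        rw [← Finset.sum_div, ← Finset.mul_sum, frameAvg]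
        push_cast
        field_simp

lemma measurable_mutualInfo_strategy (T : Strategy M) (hT : Measurable T) (j : Alloc M) :
    Measurable fun x => G.mutualInfo x (T x) j := by
  have h1 : Measurable fun x : Fin M → ℝ => (x, T x) := measurable_id.prodMk hT
  have h2 : Measurable ((fun q : (Fin M → ℝ) × Alloc M => G.mutualInfo q.1 q.2 j) ∘
      fun x : Fin M → ℝ => (x, T x)) := (measurable_mutualInfo j).comp h1
  exact h2

lemma continuous_mutualInfo_jam (hN : 0 < G.noise) (hh : ∀ m, 0 < h m) (p : Alloc M) :
    Continuous fun j : Alloc M => G.mutualInfo h p j := by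
  have h2 : Continuous ((fun q : Alloc M × Alloc M => G.mutualInfo h q.1 q.2) ∘
      fun j : Alloc M => (p, j)) := (continuous_mutualInfo hN hh).comp (by fun_prop)
  exact h2

lemma continuous_mutualInfo_tx (hN : 0 < G.noise) (hh : ∀ m, 0 < h m) (j : Alloc M) :
    Continuous fun p : Alloc M => G.mutualInfo h p j := by
  have h2 : Continuous ((fun q : Alloc M × Alloc M => G.mutualInfo h q.1 q.2) ∘
      fun p : Alloc M => (p, j)) := (continuous_mutualInfo hN hh).comp (by fun_prop)
  exact h2

/-! ### The cost of jamming an allocation -/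

lemma jamCost_le {p j : Alloc M} (hI : G.mutualInfo h p j ≤ G.rate) :
    G.jamCost h p ≤ frameAvg j := iInf₂_le j hI

lemma le_jamCost_iff {p : Alloc M} {K : ℝ≥0} :
    (K : ℝ≥0∞) ≤ G.jamCost h p ↔ ∀ j, frameAvg j < K → G.rate < G.mutualInfo h p j := by
  simp only [jamCost, le_iInf_iff, ENNReal.coe_le_coe]
  refine forall_congr' fun j => ?_
  rw [← not_le, ← not_le, not_imp_not]

@[simp] lemma jamCost_zero (hR : 0 < G.rate) : G.jamCost h 0 = 0 := by
  have := jamCost_le (G := G) (h := h) (p := 0) (j := 0) (by simpa using hR.le)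
  simpa using this

/-- The jamming `t • j` with `t < 1` is strictly below the level; the weak inequality survives the
limit `t → 1`. -/
lemma rate_le_mutualInfo (hN : 0 < G.noise) (hh : ∀ m, 0 < h m) {p j : Alloc M} {K : ℝ≥0}
    (hK : 0 < K) (hp : (K : ℝ≥0∞) ≤ G.jamCost h p) (hj : frameAvg j ≤ K) :
    G.rate ≤ G.mutualInfo h p j := by
  rw [le_jamCost_iff] at hp
  have hc : Continuous fun t : ℝ≥0 => G.mutualInfo h p (t • j) :=
    (continuous_mutualInfo_jam hN hh p).comp (by fun_prop)
  have hl : Tendsto (fun t : ℝ≥0 => G.mutualInfo h p (t • j)) (𝓝[<] 1)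
      (𝓝 (G.mutualInfo h p j)) := by
    have := (hc.tendsto 1).mono_left (nhdsWithin_le_nhds (s := Set.Iio 1))
    simpa using this
  have : (𝓝[<] (1 : ℝ≥0)).NeBot := nhdsLT_neBot_of_exists_lt ⟨0, one_pos⟩
  refine ge_of_tendsto hl (eventually_nhdsWithin_of_forall fun t ht => (hp _ ?_).le)
  rw [frameAvg_smul]
  calc t * frameAvg j ≤ t * K := by gcongr
    _ < 1 * K := by
      have : t < 1 := ht
      gcongr
    _ = K := one_mul K

/-- Jamming below `K` that brought the information down to the rate could be padded, still below
`K`, to bring it strictly under. Conditions closed in `p` therefore describe `K ≤ jamCost`. -/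
lemma le_jamCost_of_forall (hM : 0 < M) (hN : 0 < G.noise) (hR : 0 < G.rate)
    (hh : ∀ m, 0 < h m) {p : Alloc M} {K : ℝ≥0}
    (hp : ∀ j, frameAvg j < K → G.rate ≤ G.mutualInfo h p j) : (K : ℝ≥0∞) ≤ G.jamCost h p := by
  rw [le_jamCost_iff]
  intro j hj
  by_contra! hc
  obtain ⟨t, ht0, ht⟩ := exists_between (tsub_pos_of_lt hj)
  refine (mutualInfo_add_const_lt hM hN hR hh hc ht0).not_ge (hp _ ?_)
  rw [frameAvg_add, frameAvg_const hM, add_comm]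
  exact lt_tsub_iff_right.1 ht

lemma isClosed_le_jamCost (hM : 0 < M) (hN : 0 < G.noise) (hR : 0 < G.rate)
    (hh : ∀ m, 0 < h m) (K : ℝ≥0) : IsClosed {p : Alloc M | (K : ℝ≥0∞) ≤ G.jamCost h p} := by
  have : {p : Alloc M | (K : ℝ≥0∞) ≤ G.jamCost h p} =
      ⋂ j : {j : Alloc M // frameAvg j < K}, {p | G.rate ≤ G.mutualInfo h p j} := by
    ext p
    simp only [Set.mem_ofPred_eq, Set.mem_iInter, Subtype.forall]
    exact ⟨fun hp j hj => (le_jamCost_iff.1 hp j hj).le, le_jamCost_of_forall hM hN hR hh⟩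
  rw [this]
  exact isClosed_iInter fun j =>
    isClosed_le continuous_const (continuous_mutualInfo_tx hN hh _)

/-- A version of `jamCost` that is an infimum over countably many jammer allocations. -/
noncomputable def jamCostSeq (G : Game M) (h : Fin M → ℝ) (p : Alloc M) : ℝ≥0∞ :=
  ⨅ n : {n : ℕ // G.mutualInfo h p (TopologicalSpace.denseSeq (Alloc M) n) < G.rate},
    (frameAvg (TopologicalSpace.denseSeq (Alloc M) n) : ℝ≥0∞)

/-- Padding makes the rate inequality strict, hence open in the jamming allocation, so a dense
sequence meets it. Measurability of `jamCost` rests on this. -/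
lemma exists_denseSeq_of_jamCost_lt (hM : 0 < M) (hN : 0 < G.noise) (hR : 0 < G.rate)
    (hh : ∀ m, 0 < h m) {p : Alloc M} {a : ℝ≥0∞} (ha : G.jamCost h p < a) :
    ∃ n, G.mutualInfo h p (TopologicalSpace.denseSeq (Alloc M) n) < G.rate ∧
      (frameAvg (TopologicalSpace.denseSeq (Alloc M) n) : ℝ≥0∞) < a := by
  simp only [jamCost, iInf_lt_iff] at ha
  obtain ⟨j, hj, hja⟩ := ha
  obtain ⟨b, hjb, hba⟩ := ENNReal.lt_iff_exists_nnreal_btwn.1 hja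
  rw [ENNReal.coe_lt_coe] at hjb
  obtain ⟨t, ht0, ht⟩ := exists_between (tsub_pos_of_lt hjb)
  have ho : IsOpen {j' : Alloc M | G.mutualInfo h p j' < G.rate ∧ frameAvg j' < b} :=
    (isOpen_lt (continuous_mutualInfo_jam hN hh p) continuous_const).inter
      (isOpen_Iio.preimage continuous_frameAvg)
  obtain ⟨_, h1, n, rfl⟩ := (TopologicalSpace.denseRange_denseSeq (Alloc M)).inter_open_nonempty
    _ ho ⟨j + fun _ => t, mutualInfo_add_const_lt hM hN hR hh hj ht0, by
      rw [frameAvg_add, frameAvg_const hM, add_comm]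
      exact lt_tsub_iff_right.1 ht⟩
  exact ⟨n, h1.1, hba.trans' (by exact_mod_cast h1.2)⟩

lemma jamCost_eq_jamCostSeq (hM : 0 < M) (hN : 0 < G.noise) (hR : 0 < G.rate)
    (hh : ∀ m, 0 < h m) (p : Alloc M) : G.jamCost h p = G.jamCostSeq h p := by
  refine le_antisymm (le_iInf fun n => jamCost_le n.2.le) (le_of_forall_gt fun a ha => ?_)
  obtain ⟨n, h1, h2⟩ := exists_denseSeq_of_jamCost_lt hM hN hR hh ha
  rw [jamCostSeq, iInf_lt_iff]
  exact ⟨⟨n, h1⟩, h2⟩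

lemma measurable_jamCostSeq {T : Strategy M} (hT : Measurable T) :
    Measurable fun x => G.jamCostSeq x (T x) := by
  classical
  have : (fun x => G.jamCostSeq x (T x)) = fun x => ⨅ n : ℕ,
      if G.mutualInfo x (T x) (TopologicalSpace.denseSeq (Alloc M) n) < G.rate then
        (frameAvg (TopologicalSpace.denseSeq (Alloc M) n) : ℝ≥0∞) else ⊤ := by
    ext x
    rw [jamCostSeq, iInf_subtype]
    refine iInf_congr fun n => ?_
    split_ifs with hn <;> simp [hn]
  rw [this]
  exact Measurable.iInf fun n => Measurable.ite
    (measurableSet_lt (measurable_mutualInfo_strategy T hT _) measurable_const)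
    measurable_const measurable_const

/-- The cost of jamming is at most proportional to the frame power. -/
lemma jamCost_mul_rate_le (hM : 0 < M) (hN : 0 < G.noise) (hR : 0 < G.rate) (hh : ∀ m, 0 < h m)
    (p : Alloc M) :
    G.jamCost h p * ENNReal.ofReal G.rate ≤ ENNReal.ofReal (∑ m, h m) * frameAvg p := by
  have hS : 0 < ∑ m, h m := Finset.sum_pos (fun m _ => hh m) ⟨⟨0, hM⟩, Finset.mem_univ _⟩
  rcases eq_or_ne p 0 with rfl | hp
  · simp [hR]
  have ha : 0 < frameAvg p := pos_of_ne_zero fun h0 => hp ((frameAvg_eq_zero hM).1 h0)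
  -- The uniform jamming for which the bound of `mutualInfo_const_le` equals the rate.
  set t : ℝ≥0 := (∑ m, h m).toNNReal * frameAvg p / G.rate.toNNReal with ht
  have hR' : 0 < G.rate.toNNReal := by simpa using hR
  have hS' : 0 < (∑ m, h m).toNNReal := by simpa using hS
  have ht0 : 0 < t := by positivity
  have h1 : G.jamCost h p ≤ frameAvg (fun _ : Fin M => t) := by
    refine jamCost_le ((mutualInfo_const_le hM hN hh p ht0).trans (le_of_eq ?_))
    rw [ht]
    push_cast
    rw [Real.coe_toNNReal _ hS.le, Real.coe_toNNReal _ hR.le]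
    have : (frameAvg p : ℝ) ≠ 0 := by exact_mod_cast ha.ne'
    field_simp
  rw [frameAvg_const hM] at h1
  calc G.jamCost h p * ENNReal.ofReal G.rate ≤ t * ENNReal.ofReal G.rate := by gcongr
    _ = ENNReal.ofReal (∑ m, h m) * frameAvg p := by
      rw [ENNReal.ofReal, ENNReal.ofReal, ← ENNReal.coe_mul, ← ENNReal.coe_mul, ht,
        div_mul_cancel₀ _ hR'.ne']

lemma jamCost_lt_top (hM : 0 < M) (hN : 0 < G.noise) (hR : 0 < G.rate) (hh : ∀ m, 0 < h m)
    (p : Alloc M) : G.jamCost h p < ⊤ := by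
  by_contra! hc
  have := jamCost_mul_rate_le hM hN hR hh p
  rw [top_le_iff.1 hc, ENNReal.top_mul (by simpa using hR)] at this
  exact (ENNReal.mul_lt_top ENNReal.ofReal_lt_top ENNReal.coe_lt_top).not_ge this

/-- The cost of jamming grows faster than proportionally with the transmitted power. -/
lemma mul_jamCost_add_le (hN : 0 < G.noise) (hh : ∀ m, 0 < h m)
    {p : Alloc M} (hp : 0 < G.jamCost h p) {c : ℝ≥0} (hc : 1 ≤ c) :
    c * G.jamCost h p + ((c - 1) * G.noise.toNNReal / M : ℝ≥0) ≤ G.jamCost h (c • p) := by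
  refine le_iInf₂ fun j hj => ?_
  set w : ℝ≥0 := (c - 1) * G.noise.toNNReal with hw
  have hc0 : c ≠ 0 := (one_pos.trans_le hc).ne'
  have h1 := jamCost_le ((mutualInfo_le_smul hN hh p j hc).trans hj)
  rw [← hw, frameAvg_smul] at h1
  have h2 : c * G.jamCost h p ≤ frameAvg (j - fun _ => w) := by
    calc c * G.jamCost h p ≤ c * ((c⁻¹ * frameAvg (j - fun _ => w) : ℝ≥0) : ℝ≥0∞) := by gcongr
      _ = _ := by rw [← ENNReal.coe_mul, mul_inv_cancel_left₀ hc0]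
  -- Were no block above `w`, the truncated difference would vanish, against `hp`. On a block above
  -- `w` nothing is truncated, so the full `w` is regained there; averaging gives the surplus `w /
  -- M`.
  obtain ⟨m, hm⟩ : ∃ m, w < j m := by
    by_contra! hle
    have : j - (fun _ => w) = 0 := funext fun m => tsub_eq_zero_of_le (hle m)
    rw [this, frameAvg_zero, ENNReal.coe_zero, nonpos_iff_eq_zero, mul_eq_zero] at h2
    simp [hc0, hp.ne'] at h2
  refine (add_le_add_left h2 _).trans ?_
  rw [← ENNReal.coe_add, ENNReal.coe_le_coe, frameAvg, frameAvg, ← add_div]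
  gcongr
  rw [← Finset.add_sum_erase _ _ (Finset.mem_univ m), ← Finset.add_sum_erase _ j (Finset.mem_univ m),
    add_right_comm]
  refine add_le_add ?_ (Finset.sum_le_sum fun i _ => ?_)
  · simp only [Pi.sub_apply]
    rw [tsub_add_cancel_of_le hm.le]
  · simp

lemma mul_jamCost_le (hN : 0 < G.noise) (hh : ∀ m, 0 < h m) (p : Alloc M) {c : ℝ≥0}
    (hc : 1 ≤ c) : c * G.jamCost h p ≤ G.jamCost h (c • p) := by
  rcases eq_or_ne (G.jamCost h p) 0 with h0 | h0
  · simp [h0]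
  · exact le_self_add.trans (mul_jamCost_add_le hN hh (pos_of_ne_zero h0) hc)

lemma mul_jamCost_lt (hM : 0 < M) (hN : 0 < G.noise) (hR : 0 < G.rate) (hh : ∀ m, 0 < h m)
    {p : Alloc M} (hp : 0 < G.jamCost h p) {c : ℝ≥0} (hc : 1 < c) :
    c * G.jamCost h p < G.jamCost h (c • p) := by
  refine lt_of_lt_of_le (ENNReal.lt_add_right ?_ ?_) (mul_jamCost_add_le hN hh hp hc.le)
  · exact ENNReal.mul_ne_top ENNReal.coe_ne_top (jamCost_lt_top hM hN hR hh p).ne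
  · have : 0 < c - 1 := tsub_pos_of_lt hc
    have : 0 < G.noise.toNNReal := by simpa using hN
    rw [Ne, ENNReal.coe_eq_zero]
    positivity

/-! ### Allocations that reach a level with the least transmitter power -/

lemma lt_mutualInfo_of_lt_jamCost {p : Alloc M} {K : ℝ≥0} (hp : (K : ℝ≥0∞) < G.jamCost h p)
    (j : Alloc M) (hj : frameAvg j ≤ K) : G.rate < G.mutualInfo h p j := by
  obtain ⟨K', h1, h2⟩ := ENNReal.lt_iff_exists_nnreal_btwn.1 hp
  exact le_jamCost_iff.1 h2.le j (hj.trans_lt (by exact_mod_cast h1))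

/-- Joint continuity and compactness of the set of jamming allocations make the neighbourhood
uniform in `j`. -/
lemma eventually_lt_mutualInfo (hM : 0 < M) (hN : 0 < G.noise) (hh : ∀ m, 0 < h m)
    {p : Alloc M} {K : ℝ≥0} (hp : ∀ j, frameAvg j ≤ K → G.rate < G.mutualInfo h p j) :
    ∀ᶠ q in 𝓝 p, ∀ j, frameAvg j ≤ K → G.rate < G.mutualInfo h q j := by
  refine (isCompact_frameAvg_le hM K).eventually_forall_of_forall_eventually
    (P := fun q j => G.rate < G.mutualInfo h q j) fun j hj => ?_
  exact ((continuous_mutualInfo hN hh).tendsto (p, j)).eventually_const_lt (hp j hj)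

lemma le_jamCost_of_lt_mutualInfo {p : Alloc M} {K : ℝ≥0}
    (hp : ∀ j, frameAvg j ≤ K → G.rate < G.mutualInfo h p j) : (K : ℝ≥0∞) ≤ G.jamCost h p :=
  le_jamCost_iff.2 fun j hj => hp j hj.le

/-- Slack against all jamming up to `K` persists when the allocation is shrunk slightly. This
contradicts minimality in `IsLevelAlloc.jamCost_eq` and `IsLevelAlloc.unique`. -/
lemma exists_frameAvg_lt (hM : 0 < M) (hN : 0 < G.noise) (hR : 0 < G.rate) (hh : ∀ m, 0 < h m)
    {p : Alloc M} {K : ℝ≥0} (hp : ∀ j, frameAvg j ≤ K → G.rate < G.mutualInfo h p j) :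
    ∃ q, (K : ℝ≥0∞) ≤ G.jamCost h q ∧ frameAvg q < frameAvg p := by
  have hp0 : p ≠ 0 := by
    rintro rfl
    have := hp 0 (by simp)
    rw [mutualInfo_zero] at this
    exact this.not_gt hR
  have ha : 0 < frameAvg p := pos_of_ne_zero fun h0 => hp0 ((frameAvg_eq_zero hM).1 h0)
  have hc : Tendsto (fun t : ℝ≥0 => t • p) (𝓝[<] 1) (𝓝 p) := by
    have hc : Continuous fun t : ℝ≥0 => t • p := by fun_prop
    simpa using (hc.tendsto 1).mono_left (nhdsWithin_le_nhds (s := Set.Iio 1))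
  have : (𝓝[<] (1 : ℝ≥0)).NeBot := nhdsLT_neBot_of_exists_lt ⟨0, one_pos⟩
  obtain ⟨t, ht, ht1⟩ :=
    ((hc.eventually (eventually_lt_mutualInfo hM hN hh hp)).and self_mem_nhdsWithin).exists
  refine ⟨t • p, le_jamCost_of_lt_mutualInfo ht, ?_⟩
  rw [frameAvg_smul]
  exact mul_lt_of_lt_one_left ha ht1

lemma exists_le_jamCost (hM : 0 < M) (hN : 0 < G.noise) (hh : ∀ m, 0 < h m)
    (K : ℝ≥0) : ∃ p : Alloc M, (K : ℝ≥0∞) ≤ G.jamCost h p := by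
  -- Received power that keeps the signal-to-noise ratio of each block at `exp G.rate` or more, even
  -- if all the jamming, `M * K`, falls on that block.
  set t : ℝ := Real.exp G.rate * (G.noise + M * K) with ht
  have ht0 : 0 < t := by positivity
  refine ⟨fun m => (t / h m).toNNReal, le_jamCost_of_lt_mutualInfo fun j hj => ?_⟩
  have : ∀ m, G.rate < Real.log (1 + h m * ((t / h m).toNNReal : ℝ) / (G.noise + (j m : ℝ))) := by
    intro m
    have hm := hh m
    rw [Real.coe_toNNReal _ (by positivity), mul_div_cancel₀ _ hm.ne']
    refine (Real.lt_log_iff_exp_lt (by positivity)).2 ?_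
    have hjm : (j m : ℝ) ≤ M * K := by
      exact_mod_cast (le_mul_frameAvg hM j m).trans (mul_le_mul_right (α := ℝ≥0) hj _)
    have : Real.exp G.rate ≤ t / (G.noise + j m) := by
      rw [le_div_iff₀ (by positivity), ht]
      gcongr
    linarith
  unfold mutualInfo
  have hM' : (0 : ℝ) < M := by exact_mod_cast hM
  calc G.rate = (1 / (M : ℝ)) * ∑ _m : Fin M, G.rate := by
        simp
        field_simp
    _ < _ := mul_lt_mul_of_pos_left
      (Finset.sum_lt_sum_of_nonempty ⟨⟨0, hM⟩, Finset.mem_univ _⟩ fun m _ => this m)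
      (by positivity)

lemma requiredTx_le {p : Alloc M} {K : ℝ≥0} (hp : (K : ℝ≥0∞) ≤ G.jamCost h p) :
    G.requiredTx K h ≤ frameAvg p :=
  iInf₂_le (frameAvg p) (hp.trans (le_iSup₂ (f := fun p' (_ : frameAvg p' ≤ frameAvg p) =>
    G.jamCost h p') p le_rfl))

/-- `p` raises the cost of jamming to `K` or more with the least possible frame power. -/
def IsLevelAlloc (G : Game M) (K : ℝ≥0) (h : Fin M → ℝ) (p : Alloc M) : Prop :=
  (K : ℝ≥0∞) ≤ G.jamCost h p ∧ (frameAvg p : ℝ≥0∞) = G.requiredTx K h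

/-- The allocations that reach `K` form a closed set, and bounded frame power makes it compact, so a
cheapest one exists. -/
lemma exists_isLevelAlloc (hM : 0 < M) (hN : 0 < G.noise) (hR : 0 < G.rate) (hh : ∀ m, 0 < h m)
    {K : ℝ≥0} (hK : 0 < K) : ∃ p, G.IsLevelAlloc K h p := by
  obtain ⟨p₁, hp₁⟩ := exists_le_jamCost (G := G) hM hN hh K
  obtain ⟨p, ⟨hpS, hpa⟩, hmin⟩ := ((isCompact_frameAvg_le hM (frameAvg p₁)).inter_left
    (isClosed_le_jamCost hM hN hR hh K)).exists_isMinOn ⟨p₁, hp₁, le_rfl (a := frameAvg p₁)⟩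
    continuous_frameAvg.continuousOn
  have hmin' : ∀ q, (K : ℝ≥0∞) ≤ G.jamCost h q → frameAvg p ≤ frameAvg q := by
    intro q hq
    rcases le_total (frameAvg q) (frameAvg p₁) with hle | hle
    · exact hmin ⟨hq, hle⟩
    · exact le_trans hpa hle
  refine ⟨p, hpS, le_antisymm (le_iInf₂ fun P hP => ?_) (requiredTx_le hpS)⟩
  rw [ENNReal.coe_le_coe]
  -- Attainment of the supremum in `requiredJam` is not used: an allocation that reaches `K / c` is
  -- scaled by `c` to reach `K`, and `c` tends to 1.
  have hscale : ∀ c : ℝ≥0, 1 < c → frameAvg p ≤ c * P := by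
    intro c hc
    have hlt : ((K / c : ℝ≥0) : ℝ≥0∞) < G.requiredJam P h :=
      lt_of_lt_of_le (by exact_mod_cast div_lt_self hK hc) hP
    simp only [requiredJam, lt_iSup_iff] at hlt
    obtain ⟨q, hq, hlt⟩ := hlt
    have hc0 : c ≠ 0 := (one_pos.trans hc).ne'
    have h1 : (K : ℝ≥0∞) ≤ G.jamCost h (c • q) := by
      refine le_trans ?_ (mul_jamCost_le hN hh q hc.le)
      calc (K : ℝ≥0∞) = c * (K / c : ℝ≥0) := by rw [← ENNReal.coe_mul, mul_div_cancel₀ _ hc0]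
        _ ≤ _ := by gcongr
    refine (hmin' _ h1).trans ?_
    rw [frameAvg_smul]
    gcongr
  have hc : Continuous fun c : ℝ≥0 => c * P := by fun_prop
  have hl : Tendsto (fun c : ℝ≥0 => c * P) (𝓝[>] 1) (𝓝 P) := by
    simpa using (hc.tendsto 1).mono_left (nhdsWithin_le_nhds (s := Set.Ioi 1))
  exact ge_of_tendsto hl (eventually_nhdsWithin_of_forall hscale)

lemma IsLevelAlloc.frameAvg_le {K : ℝ≥0} {p q : Alloc M} (hp : G.IsLevelAlloc K h p)
    (hq : (K : ℝ≥0∞) ≤ G.jamCost h q) : frameAvg p ≤ frameAvg q := by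
  have := requiredTx_le hq
  rw [← hp.2] at this
  exact_mod_cast this

lemma IsLevelAlloc.jamCost_eq (hM : 0 < M) (hN : 0 < G.noise) (hR : 0 < G.rate)
    (hh : ∀ m, 0 < h m) {K : ℝ≥0} {p : Alloc M} (hp : G.IsLevelAlloc K h p) :
    G.jamCost h p = K := by
  refine le_antisymm ?_ hp.1
  by_contra! hlt
  obtain ⟨q, hq, hqp⟩ := exists_frameAvg_lt hM hN hR hh (lt_mutualInfo_of_lt_jamCost hlt)
  exact (hp.frameAvg_le hq).not_gt hqp

/-- The midpoint of two minimizers would have slack by strict concavity, and so could be made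
cheaper. -/
lemma IsLevelAlloc.unique (hM : 0 < M) (hN : 0 < G.noise) (hR : 0 < G.rate)
    (hh : ∀ m, 0 < h m) {K : ℝ≥0} (hK : 0 < K) {p q : Alloc M} (hp : G.IsLevelAlloc K h p)
    (hq : G.IsLevelAlloc K h q) : p = q := by
  by_contra hpq
  have hpa : frameAvg p = frameAvg q := le_antisymm (hp.frameAvg_le hq.1) (hq.frameAvg_le hp.1)
  obtain ⟨r, hr, hlt⟩ := exists_frameAvg_lt hM hN hR hh (K := K)
    (p := (2 : ℝ≥0)⁻¹ • (p + q)) fun j hj => lt_mutualInfo_midpoint hM hN hh hpq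
      (rate_le_mutualInfo hN hh hK hp.1 hj) (rate_le_mutualInfo hN hh hK hq.1 hj)
  rw [frameAvg_smul, frameAvg_add, ← hpa, ← two_mul, inv_mul_cancel_left₀ two_ne_zero] at hlt
  exact (hp.frameAvg_le hr).not_gt hlt

lemma requiredTx_lt_top (hM : 0 < M) (hN : 0 < G.noise) (hh : ∀ m, 0 < h m)
    (K : ℝ≥0) : G.requiredTx K h < ⊤ := by
  obtain ⟨p, hp⟩ := exists_le_jamCost (G := G) hM hN hh K
  exact (requiredTx_le hp).trans_lt ENNReal.coe_lt_top

lemma requiredTx_mono {K K' : ℝ≥0} (hK : K ≤ K') : G.requiredTx K h ≤ G.requiredTx K' h :=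
  iInf_mono fun _ => iInf_mono' fun hP => ⟨le_trans (by exact_mod_cast hK) hP, le_rfl⟩

/-- The scaled level allocation is a competitor. Through `Proper.coverage_le_mul` this bound yields
continuity of `gain`. -/
lemma requiredTx_mul_le (hM : 0 < M) (hN : 0 < G.noise) (hR : 0 < G.rate) (hh : ∀ m, 0 < h m)
    {K c : ℝ≥0} (hK : 0 < K) (hc : 1 ≤ c) : G.requiredTx (c * K) h ≤ c * G.requiredTx K h := by
  obtain ⟨p, hp⟩ := exists_isLevelAlloc hM hN hR hh hK
  have h1 : ((c * K : ℝ≥0) : ℝ≥0∞) ≤ G.jamCost h (c • p) := by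
    refine le_trans ?_ (mul_jamCost_le hN hh p hc)
    rw [ENNReal.coe_mul]
    exact mul_le_mul_right hp.1 _
  refine (requiredTx_le h1).trans_eq ?_
  rw [frameAvg_smul, ← hp.2, ENNReal.coe_mul]

lemma mul_rate_le_requiredTx (hM : 0 < M) (hN : 0 < G.noise) (hR : 0 < G.rate)
    (hh : ∀ m, 0 < h m) {K : ℝ≥0} (hK : 0 < K) :
    K * ENNReal.ofReal G.rate ≤ ENNReal.ofReal (∑ m, h m) * G.requiredTx K h := by
  obtain ⟨p, hp⟩ := exists_isLevelAlloc hM hN hR hh hK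
  rw [← hp.2, ← hp.jamCost_eq hM hN hR hh]
  exact jamCost_mul_rate_le hM hN hR hh p

/-- Scaling the level allocation by `c > 1` exceeds the level strictly, which is stable under small
changes of the allocation; a dense sequence then suffices. -/
lemma exists_denseSeq_of_requiredTx_lt (hM : 0 < M) (hN : 0 < G.noise) (hR : 0 < G.rate)
    (hh : ∀ m, 0 < h m) {K : ℝ≥0} (hK : 0 < K) {a : ℝ≥0∞} (ha : G.requiredTx K h < a) :
    ∃ n, (K : ℝ≥0∞) ≤ G.jamCost h (TopologicalSpace.denseSeq (Alloc M) n) ∧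
      (frameAvg (TopologicalSpace.denseSeq (Alloc M) n) : ℝ≥0∞) < a := by
  obtain ⟨p, hp⟩ := exists_isLevelAlloc hM hN hR hh hK
  rw [← hp.2] at ha
  obtain ⟨b, hpb, hba⟩ := ENNReal.lt_iff_exists_nnreal_btwn.1 ha
  rw [ENNReal.coe_lt_coe] at hpb
  have hl : Tendsto (fun c : ℝ≥0 => c * frameAvg p) (𝓝[>] 1) (𝓝 (frameAvg p)) := by
    have hc : Continuous fun c : ℝ≥0 => c * frameAvg p := by fun_prop
    simpa using (hc.tendsto 1).mono_left (nhdsWithin_le_nhds (s := Set.Ioi 1))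
  obtain ⟨c, hcb, hc⟩ := ((hl.eventually_lt_const hpb).and self_mem_nhdsWithin).exists
  have hlt : (K : ℝ≥0∞) < G.jamCost h (c • p) := by
    have h1 := mul_jamCost_lt (G := G) hM hN hR hh (p := p)
      (lt_of_lt_of_le (by exact_mod_cast hK) hp.1) hc
    refine lt_of_le_of_lt ?_ h1
    rw [hp.jamCost_eq hM hN hR hh, ← ENNReal.coe_mul, ENNReal.coe_le_coe]
    exact le_mul_of_one_le_left zero_le (le_of_lt hc)
  have hev := (eventually_lt_mutualInfo hM hN hh (lt_mutualInfo_of_lt_jamCost hlt)).and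
    ((continuous_frameAvg.tendsto (c • p)).eventually_lt_const (by rwa [frameAvg_smul]))
  obtain ⟨_, h1, n, rfl⟩ := mem_closure_iff_nhds.1
    (TopologicalSpace.denseRange_denseSeq (Alloc M) (c • p)) _ hev
  exact ⟨n, le_jamCost_of_lt_mutualInfo h1.1, hba.trans' (by exact_mod_cast h1.2)⟩

/-- A version of `requiredTx` that is an infimum over countably many allocations. -/
noncomputable def requiredTxSeq (G : Game M) (K : ℝ≥0) (h : Fin M → ℝ) : ℝ≥0∞ :=
  ⨅ n : {n : ℕ // (K : ℝ≥0∞) ≤ G.jamCostSeq h (TopologicalSpace.denseSeq (Alloc M) n)},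
    (frameAvg (TopologicalSpace.denseSeq (Alloc M) n) : ℝ≥0∞)

lemma requiredTx_eq_requiredTxSeq (hM : 0 < M) (hN : 0 < G.noise) (hR : 0 < G.rate)
    (hh : ∀ m, 0 < h m) {K : ℝ≥0} (hK : 0 < K) : G.requiredTx K h = G.requiredTxSeq K h := by
  refine le_antisymm (le_iInf fun n => requiredTx_le ?_) (le_of_forall_gt fun a ha => ?_)
  · rw [jamCost_eq_jamCostSeq hM hN hR hh]
    exact n.2
  · obtain ⟨n, h1, h2⟩ := exists_denseSeq_of_requiredTx_lt hM hN hR hh hK ha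
    rw [jamCost_eq_jamCostSeq hM hN hR hh] at h1
    rw [requiredTxSeq, iInf_lt_iff]
    exact ⟨⟨n, h1⟩, h2⟩

lemma measurable_requiredTxSeq (K : ℝ≥0) : Measurable (G.requiredTxSeq K) := by
  classical
  have : G.requiredTxSeq K = fun x => ⨅ n : ℕ,
      if (K : ℝ≥0∞) ≤ G.jamCostSeq x (TopologicalSpace.denseSeq (Alloc M) n) then
        (frameAvg (TopologicalSpace.denseSeq (Alloc M) n) : ℝ≥0∞) else ⊤ := by
    ext x
    rw [requiredTxSeq, iInf_subtype]
    refine iInf_congr fun n => ?_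
    split_ifs with hn <;> simp [hn]
  rw [this]
  exact Measurable.iInf fun n => Measurable.ite
    (measurableSet_le measurable_const (measurable_jamCostSeq measurable_const))
    measurable_const measurable_const

/-- The fraction of the level that an allocation reaches costs at least that fraction of the
power required for the level. -/
lemma min_mul_requiredTx_le (hN : 0 < G.noise) (hh : ∀ m, 0 < h m)
    {K : ℝ≥0} (hK : 0 < K) (p : Alloc M) :
    min (G.jamCost h p / K) 1 * G.requiredTx K h ≤ frameAvg p := by
  rcases le_or_gt (K : ℝ≥0∞) (G.jamCost h p) with hle | hlt
  · calc min (G.jamCost h p / K) 1 * G.requiredTx K h ≤ 1 * G.requiredTx K h := by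
          gcongr
          exact min_le_right _ _
      _ ≤ frameAvg p := by
          rw [one_mul]
          exact requiredTx_le hle
  have hne : G.jamCost h p ≠ ⊤ := hlt.ne_top
  rcases eq_or_ne (G.jamCost h p) 0 with h0 | h0
  · simp [h0]
  lift G.jamCost h p to ℝ≥0 using hne with c hc
  have hc0 : c ≠ 0 := by exact_mod_cast h0
  have hcK : c < K := by exact_mod_cast hlt
  have h1 : G.requiredTx K h ≤ (K / c : ℝ≥0) * frameAvg p := by
    have : (K : ℝ≥0∞) ≤ G.jamCost h ((K / c) • p) := by
      refine le_trans ?_ (mul_jamCost_le hN hh p ((one_le_div₀ (pos_of_ne_zero hc0)).2 hcK.le))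
      rw [← hc, ← ENNReal.coe_mul, div_mul_cancel₀ _ hc0]
    refine (requiredTx_le this).trans_eq ?_
    rw [frameAvg_smul, ENNReal.coe_mul]
  calc min ((c : ℝ≥0∞) / K) 1 * G.requiredTx K h
      ≤ (c : ℝ≥0∞) / K * ((K / c : ℝ≥0) * frameAvg p) := by
        gcongr
        exact min_le_left _ _
    _ = frameAvg p := by
        rw [← ENNReal.coe_div hK.ne', ← mul_assoc, ← ENNReal.coe_mul, div_mul_div_comm,
          mul_comm c K, div_self (by positivity), ENNReal.coe_one, one_mul]

/-- A fraction strictly between 0 and 1 cannot be tight: the allocation scaled by `K / c` would have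
the least power for `K` yet overshoot `K`, by `mul_jamCost_lt`. -/
lemma isLevelAlloc_of_min_mul_requiredTx_eq (hM : 0 < M) (hN : 0 < G.noise) (hR : 0 < G.rate)
    (hh : ∀ m, 0 < h m) {K : ℝ≥0} {p : Alloc M} (hp : p ≠ 0)
    (he : min (G.jamCost h p / K) 1 * G.requiredTx K h = frameAvg p) :
    G.IsLevelAlloc K h p := by
  rcases le_or_gt (K : ℝ≥0∞) (G.jamCost h p) with hle | hlt
  · refine ⟨hle, le_antisymm ?_ (requiredTx_le hle)⟩
    calc (frameAvg p : ℝ≥0∞) ≤ 1 * G.requiredTx K h := by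
          rw [← he]
          gcongr
          exact min_le_right _ _
      _ = _ := one_mul _
  exfalso
  have hpa : frameAvg p ≠ 0 := fun h0 => hp ((frameAvg_eq_zero hM).1 h0)
  rcases eq_or_ne (G.jamCost h p) 0 with h0 | h0
  · rw [h0] at he
    simp [hpa.symm] at he
  have hne : G.jamCost h p ≠ ⊤ := hlt.ne_top
  have hcpos : 0 < G.jamCost h p := pos_of_ne_zero h0
  lift G.jamCost h p to ℝ≥0 using hne with c hc
  have hc0 : 0 < c := by exact_mod_cast hcpos
  have hcK : c < K := by exact_mod_cast hlt
  have hlt' : (K : ℝ≥0∞) < G.jamCost h ((K / c) • p) := by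
    refine lt_of_le_of_lt ?_ (mul_jamCost_lt hM hN hR hh (hc ▸ hcpos) ((one_lt_div₀ hc0).2 hcK))
    rw [← hc, ← ENNReal.coe_mul, div_mul_cancel₀ _ hc0.ne']
  have hlevel : G.IsLevelAlloc K h ((K / c) • p) := by
    refine ⟨hlt'.le, le_antisymm ?_ (requiredTx_le hlt'.le)⟩
    rw [frameAvg_smul, ENNReal.coe_mul, ← he]
    calc ((K / c : ℝ≥0) : ℝ≥0∞) * (min ((c : ℝ≥0∞) / K) 1 * G.requiredTx K h)
        ≤ (K / c : ℝ≥0) * ((c : ℝ≥0∞) / K * G.requiredTx K h) := by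
          gcongr
          exact min_le_left _ _
      _ = G.requiredTx K h := by
          rw [← ENNReal.coe_div (hc0.trans hcK).ne', ← mul_assoc, ← ENNReal.coe_mul,
            div_mul_div_comm, mul_comm c K, div_self (mul_pos (hc0.trans hcK) hc0).ne',
            ENNReal.coe_one, one_mul]
  exact (hlevel.jamCost_eq hM hN hR hh).not_gt hlt'

/-! ### Measurable selections -/

/-- The least good index is taken. The extra alternative makes the search succeed also where no
index is good. -/
lemma exists_measurable_index {Ω : Type*} [MeasurableSpace Ω] {good : ℕ → Ω → Prop}
    (hg : ∀ n, MeasurableSet {x | good n x}) :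
    ∃ N : Ω → ℕ, Measurable N ∧ ∀ x, (∃ n, good n x) → good (N x) x := by
  classical
  have hex : ∀ x, ∃ n, good n x ∨ ¬ ∃ k, good k x := fun x => by
    by_cases hx : ∃ k, good k x
    · exact hx.imp fun _ => Or.inl
    · exact ⟨0, Or.inr hx⟩
  refine ⟨fun x => Nat.find (hex x), measurable_find hex fun n => ?_, fun x hx => ?_⟩
  · have : MeasurableSet {x | ∃ k, good k x} := by
      rw [Set.ofPred_exists]
      exact MeasurableSet.iUnion hg
    exact (hg n).union this.compl
  · exact (Nat.find_spec (hex x)).resolve_right (not_not.2 hx)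

lemma measurableSet_forall_pos : MeasurableSet {x : Fin M → ℝ | ∀ m, 0 < x m} := by
  rw [Set.ofPred_forall]
  exact MeasurableSet.iInter fun m => measurableSet_lt measurable_const (measurable_pi_apply m)

/-- Near-minimizers are selected measurably from a dense sequence. They stay in a compact set and
every cluster point is a level allocation, so uniqueness makes them converge, and the limit is
measurable. -/
lemma exists_measurable_isLevelAlloc (hM : 0 < M) (hN : 0 < G.noise) (hR : 0 < G.rate)
    {K : ℝ≥0} (hK : 0 < K) :
    ∃ T : Strategy M, Measurable T ∧ ∀ x, (∀ m, 0 < x m) → G.IsLevelAlloc K x (T x) := by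
  classical
  set q := TopologicalSpace.denseSeq (Alloc M) with hq
  have hsel : ∀ k : ℕ, ∃ N : (Fin M → ℝ) → ℕ, Measurable N ∧ ∀ x, (∀ m, 0 < x m) →
      (K : ℝ≥0∞) ≤ G.jamCost x (q (N x)) ∧
        (frameAvg (q (N x)) : ℝ≥0∞) < G.requiredTx K x + ((k : ℝ≥0∞) + 1)⁻¹ := by
    intro k
    obtain ⟨N, hN1, hN2⟩ := exists_measurable_index (good := fun n (x : Fin M → ℝ) =>
      (K : ℝ≥0∞) ≤ G.jamCostSeq x (q n) ∧
        (frameAvg (q n) : ℝ≥0∞) < G.requiredTxSeq K x + ((k : ℝ≥0∞) + 1)⁻¹) fun n =>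
      (measurableSet_le measurable_const (measurable_jamCostSeq measurable_const)).inter
        (measurableSet_lt measurable_const ((measurable_requiredTxSeq K).add measurable_const))
    refine ⟨N, hN1, fun x hx => ?_⟩
    rw [jamCost_eq_jamCostSeq hM hN hR hx, requiredTx_eq_requiredTxSeq hM hN hR hx hK]
    refine hN2 x ?_
    obtain ⟨n, h1, h2⟩ := exists_denseSeq_of_requiredTx_lt hM hN hR hx hK
      (a := G.requiredTx K x + ((k : ℝ≥0∞) + 1)⁻¹)
      (ENNReal.lt_add_right (requiredTx_lt_top hM hN hx K).ne (by simp))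
    rw [jamCost_eq_jamCostSeq hM hN hR hx] at h1
    rw [requiredTx_eq_requiredTxSeq hM hN hR hx hK] at h2
    exact ⟨n, h1, h2⟩
  choose N hN1 hN2 using hsel
  have hlev : ∀ x : Fin M → ℝ, ∃ p : Alloc M, (∀ m, 0 < x m) → G.IsLevelAlloc K x p := fun x => by
    by_cases hx : ∀ m, 0 < x m
    · exact (exists_isLevelAlloc hM hN hR hx hK).imp fun _ hp _ => hp
    · exact ⟨0, fun h => absurd h hx⟩
  choose T hT using hlev
  refine ⟨fun x => if ∀ m, 0 < x m then T x else 0, ?_, fun x hx => by simpa [hx] using hT x hx⟩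
  refine measurable_of_tendsto_metrizable
    (f := fun k x => if ∀ m, 0 < x m then q (N k x) else (0 : Alloc M)) (fun k => ?_) ?_
  · exact Measurable.ite measurableSet_forall_pos
      ((measurable_from_top (f := q)).comp (hN1 k)) measurable_const
  rw [tendsto_pi_nhds]
  intro x
  by_cases hx : ∀ m, 0 < x m
  swap
  · simp only [hx, if_false]
    exact tendsto_const_nhds
  simp only [hx, implies_true, if_true]
  have hlim : Tendsto (fun k : ℕ => G.requiredTx K x + ((k : ℝ≥0∞) + 1)⁻¹) atTop
      (𝓝 (G.requiredTx K x)) := by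
    have : Tendsto (fun k : ℕ => ((k : ℝ≥0∞) + 1)⁻¹) atTop (𝓝 0) := by
      have := (tendsto_add_atTop_iff_nat 1).2 ENNReal.tendsto_inv_nat_nhds_zero
      simpa using this
    simpa using tendsto_const_nhds.add this
  refine (isCompact_frameAvg_le hM (frameAvg (T x) + 1)).tendsto_nhds_of_unique_mapClusterPt
    (Eventually.of_forall fun k => ?_) fun p _ hp => ?_
  · have h1 := (hN2 k x hx).2
    rw [← (hT x hx).2] at h1
    have h2 : (frameAvg (T x) : ℝ≥0∞) + ((k : ℝ≥0∞) + 1)⁻¹ ≤ (frameAvg (T x) + 1 : ℝ≥0) := by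
      push_cast
      gcongr
      rw [ENNReal.inv_le_one]
      simp
    exact_mod_cast (h1.trans_le h2).le
  · have hpS : (K : ℝ≥0∞) ≤ G.jamCost x p :=
      (isClosed_le_jamCost hM hN hR hx K).mem_of_mapClusterPt hp
        (Eventually.of_forall fun k => (hN2 k x hx).1)
    refine IsLevelAlloc.unique hM hN hR hx hK ⟨hpS, le_antisymm ?_ (requiredTx_le hpS)⟩ (hT x hx)
    refine le_of_forall_gt fun a ha => ?_
    obtain ⟨b, hb1, hba⟩ := exists_between ha
    refine lt_of_le_of_lt ?_ hba
    have hcl : IsClosed {p : Alloc M | (frameAvg p : ℝ≥0∞) ≤ b} :=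
      isClosed_le (ENNReal.continuous_coe.comp continuous_frameAvg) continuous_const
    refine hcl.mem_of_mapClusterPt hp ?_
    filter_upwards [hlim.eventually_lt_const hb1] with k hk
    exact (hN2 k x hx).2.le.trans hk.le

end Game

/-! ### Fractional packing into an atomless probability space -/

section Packing

variable {Ω : Type*} [MeasurableSpace Ω]

/-- The threshold is the supremum of all `t` with `ν {f < t} ≤ B`; the two bounds are continuity of
`ν` from below and, thanks to `hfin`, from above. -/
lemma exists_threshold (ν : Measure Ω) {f : Ω → ℝ≥0∞} (hf : Measurable f) {B : ℝ≥0∞}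
    (hfin : ∀ t < ⊤, ν {ω | f ω < t} < ⊤) (hB : B ≤ ν Set.univ) :
    ∃ θ : ℝ≥0∞, ν {ω | f ω < θ} ≤ B ∧ B ≤ ν {ω | f ω ≤ θ} := by
  set S : Set ℝ≥0∞ := {t | ν {ω | f ω < t} ≤ B} with hS
  have hS0 : S.Nonempty := ⟨0, by simp [hS]⟩
  refine ⟨sSup S, ?_, ?_⟩
  · obtain ⟨u, hu, hlim, hmem⟩ := exists_seq_tendsto_sSup hS0 (OrderTop.bddAbove S)
    have : {ω | f ω < sSup S} = ⋃ n, {ω | f ω < u n} := by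
      ext ω
      simp only [Set.mem_ofPred_eq, Set.mem_iUnion]
      refine ⟨fun h => (hlim.eventually_const_lt h).exists, fun ⟨n, hn⟩ => ?_⟩
      exact hn.trans_le (le_sSup (hmem n))
    rw [this, Monotone.measure_iUnion (s := fun n => {ω | f ω < u n}) fun m n hmn ω (hω : f ω < u m) =>
      show f ω < u n from hω.trans_le (hu hmn)]
    exact iSup_le hmem
  · rcases eq_or_ne (sSup S) ⊤ with htop | htop
    · simpa [htop] using hB
    obtain ⟨u, hu, hmem, hlim⟩ := exists_seq_strictAnti_tendsto' (lt_top_iff_ne_top.2 htop)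
    have : {ω | f ω ≤ sSup S} = ⋂ n, {ω | f ω < u n} := by
      ext ω
      simp only [Set.mem_ofPred_eq, Set.mem_iInter]
      exact ⟨fun h n => h.trans_lt (hmem n).1, fun h => ge_of_tendsto' hlim fun n => (h n).le⟩
    have ht := tendsto_measure_iInter_atTop (μ := ν) (s := fun n => {ω | f ω < u n})
      (fun n => (measurableSet_lt hf measurable_const).nullMeasurableSet)
      (fun m n hmn ω (hω : f ω < u n) => show f ω < u m from hω.trans_le (hu.antitone hmn)) ⟨0, (hfin _ (hmem 0).2).ne⟩
    rw [this]
    refine ge_of_tendsto' ht fun n => ?_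
    by_contra! hlt
    exact (hmem n).1.not_ge (le_sSup (show u n ∈ S from hlt.le))

/-- Every measurable set has measurable subsets of every smaller measure. -/
def Divisible (μ : Measure Ω) : Prop :=
  ∀ E, MeasurableSet E → ∀ r ≤ μ E, ∃ D ⊆ E, MeasurableSet D ∧ μ D = r

lemma divisible_of_absolutelyContinuous {M : ℕ} (hM : 0 < M) (μ : Measure (Fin M → ℝ))
    [IsFiniteMeasure μ] (hμ : μ ≪ volume) : Divisible μ := by
  intro E hE r hr
  -- A strictly increasing function of one coordinate: its level sets lie in null hyperplanes, so
  -- the threshold cuts off measure exactly `r`.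
  set f : (Fin M → ℝ) → ℝ≥0∞ := fun x => ENNReal.ofReal (Real.exp (x ⟨0, hM⟩)) with hf
  have hfm : Measurable f :=
    (Real.measurable_exp.comp (measurable_pi_apply _)).ennreal_ofReal
  obtain ⟨θ, h1, h2⟩ := exists_threshold (μ.restrict E) hfm (B := r)
    (fun t _ => measure_lt_top _ _) (by simpa using hr)
  have hnull : μ {x | f x = θ} = 0 := by
    refine hμ (measure_mono_null (t := {x | x ⟨0, hM⟩ = Real.log θ.toReal}) ?_ ?_)
    · intro x hx
      simp only [Set.mem_ofPred_eq] at hx ⊢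
      rw [← hx, hf, ENNReal.toReal_ofReal (Real.exp_pos _).le, Real.log_exp]
    · rw [volume_pi]
      exact Measure.pi_hyperplane _ _ _
  refine ⟨{x | f x < θ} ∩ E, Set.inter_subset_right,
    (measurableSet_lt hfm measurable_const).inter hE, ?_⟩
  rw [← Measure.restrict_apply (measurableSet_lt hfm measurable_const)]
  refine le_antisymm h1 (h2.trans ?_)
  have : {x | f x ≤ θ} ⊆ {x | f x < θ} ∪ {x | f x = θ} :=
    fun x (hx : f x ≤ θ) => hx.lt_or_eq.imp id id
  refine (measure_mono this).trans ((measure_union_le _ _).trans ?_)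
  rw [Measure.absolutelyContinuous_of_le Measure.restrict_le_self hnull, add_zero]

variable (μ : Measure Ω)

/-- `x` is a fractional selection of `Ω` whose cost is within the budget. -/
structure IsPacking (c : Ω → ℝ≥0∞) (B : ℝ≥0∞) (x : Ω → ℝ≥0∞) : Prop where
  aemeasurable : AEMeasurable x μ
  le_one : ∀ ω, x ω ≤ 1
  cost_le : ∫⁻ ω, x ω * c ω ∂μ ≤ B

/-- The greatest measure of a fractional selection with cost `c` and budget `B`. -/
noncomputable def packValue (c : Ω → ℝ≥0∞) (B : ℝ≥0∞) : ℝ≥0∞ :=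
  ⨆ (x : Ω → ℝ≥0∞) (_ : IsPacking μ c B x), ∫⁻ ω, x ω ∂μ

variable {μ} {c c' : Ω → ℝ≥0∞} {B : ℝ≥0∞}

lemma IsPacking.lintegral_le {x : Ω → ℝ≥0∞} (hx : IsPacking μ c B x) :
    ∫⁻ ω, x ω ∂μ ≤ packValue μ c B :=
  le_iSup₂ (f := fun x (_ : IsPacking μ c B x) => ∫⁻ ω, x ω ∂μ) x hx

lemma packValue_le_one [IsProbabilityMeasure μ] : packValue μ c B ≤ 1 :=
  iSup₂_le fun _ hx => (lintegral_mono hx.le_one).trans (by simp)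

lemma packValue_anti (h : ∀ᵐ ω ∂μ, c ω ≤ c' ω) : packValue μ c' B ≤ packValue μ c B :=
  iSup₂_le fun _ hx => IsPacking.lintegral_le ⟨hx.aemeasurable, hx.le_one,
    (lintegral_mono_ae (h.mono fun _ hω => mul_le_mul_right hω _)).trans hx.cost_le⟩

lemma IsPacking.scale {x : Ω → ℝ≥0∞} (hx : IsPacking μ c B x) {a : ℝ≥0} (ha : 1 ≤ a) :
    IsPacking μ c ((a : ℝ≥0∞)⁻¹ * B) (fun ω => (a : ℝ≥0∞)⁻¹ * x ω) where
  aemeasurable := hx.aemeasurable.const_mul _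
  le_one ω := mul_le_one' (ENNReal.inv_le_one.2 (by exact_mod_cast ha)) (hx.le_one ω)
  cost_le := by
    simp only [mul_assoc]
    rw [lintegral_const_mul' _ _ (by simpa using (one_pos.trans_le ha).ne')]
    exact mul_le_mul_right hx.cost_le _

lemma IsPacking.lintegral_eq_mul {x : Ω → ℝ≥0∞} {a : ℝ≥0} (ha : 1 ≤ a) :
    ∫⁻ ω, x ω ∂μ = a * ∫⁻ ω, (a : ℝ≥0∞)⁻¹ * x ω ∂μ := by
  have ha0 : (a : ℝ≥0∞) ≠ 0 := by exact_mod_cast (one_pos.trans_le ha).ne'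
  rw [lintegral_const_mul' _ _ (by simpa using ha0), ← mul_assoc,
    ENNReal.mul_inv_cancel ha0 ENNReal.coe_ne_top, one_mul]

lemma packValue_le_mul_budget {a : ℝ≥0} (ha : 1 ≤ a) :
    packValue μ c B ≤ a * packValue μ c ((a : ℝ≥0∞)⁻¹ * B) :=
  iSup₂_le fun x hx => by
    rw [IsPacking.lintegral_eq_mul ha]
    exact mul_le_mul_right (hx.scale ha).lintegral_le _

lemma packValue_le_mul {a : ℝ≥0} (ha : 1 ≤ a) (h : ∀ᵐ ω ∂μ, c' ω ≤ a * c ω) :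
    packValue μ c B ≤ a * packValue μ c' B :=
  iSup₂_le fun x hx => by
    have ha0 : (a : ℝ≥0∞) ≠ 0 := by exact_mod_cast (one_pos.trans_le ha).ne'
    rw [IsPacking.lintegral_eq_mul ha]
    refine mul_le_mul_right (IsPacking.lintegral_le (c := c') (B := B)
      ⟨(hx.scale ha).aemeasurable, (hx.scale ha).le_one, le_trans ?_ hx.cost_le⟩) _
    refine lintegral_mono_ae (h.mono fun ω hω => ?_)
    calc (a : ℝ≥0∞)⁻¹ * x ω * c' ω ≤ (a : ℝ≥0∞)⁻¹ * x ω * (a * c ω) := by gcongr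
      _ = (a : ℝ≥0∞)⁻¹ * a * (x ω * c ω) := by ring
      _ = x ω * c ω := by rw [ENNReal.inv_mul_cancel ha0 ENNReal.coe_ne_top, one_mul]

lemma packValue_eq_one [IsProbabilityMeasure μ] (h : ∫⁻ ω, c ω ∂μ ≤ B) : packValue μ c B = 1 := by
  refine le_antisymm packValue_le_one ?_
  have : IsPacking μ c B fun _ => 1 := ⟨aemeasurable_const, fun _ => le_rfl, by simpa using h⟩
  simpa using this.lintegral_le

/-! ### Greedy sets -/

/-- `A` consists of the cheapest points and exhausts the budget. -/
structure IsGreedy (μ : Measure Ω) (c : Ω → ℝ≥0∞) (B θ : ℝ≥0∞) (A : Set Ω) : Prop where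
  ne_zero : θ ≠ 0
  ne_top : θ ≠ ⊤
  measurableSet : MeasurableSet A
  mem_of_lt : ∀ᵐ ω ∂μ, c ω < θ → ω ∈ A
  le_of_mem : ∀ᵐ ω ∂μ, ω ∈ A → c ω ≤ θ
  cost_eq : ∫⁻ ω in A, c ω ∂μ = B

lemma exists_isGreedy [IsFiniteMeasure μ] (hμ : Divisible μ) (hc : AEMeasurable c μ)
    (hfin : ∀ᵐ ω ∂μ, c ω < ⊤) (hB0 : B ≠ 0) (hB : B < ∫⁻ ω, c ω ∂μ) :
    ∃ θ A, IsGreedy μ c B θ A := by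
  wlog hcm : Measurable c generalizing c
  · have hae := hc.ae_eq_mk
    obtain ⟨θ, A, h⟩ := this (c := hc.mk c) hc.measurable_mk.aemeasurable
      (by filter_upwards [hfin, hae] with ω h1 h2; rwa [← h2])
      (by rwa [← lintegral_congr_ae hae]) hc.measurable_mk
    refine ⟨θ, A, h.ne_zero, h.ne_top, h.measurableSet, ?_, ?_, ?_⟩
    · filter_upwards [h.mem_of_lt, hae] with ω h1 h2
      rwa [h2]
    · filter_upwards [h.le_of_mem, hae] with ω h1 h2
      rwa [h2]
    · rw [← h.cost_eq]
      exact lintegral_congr_ae (ae_restrict_of_ae hae)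
  have hlt : ∀ t, MeasurableSet {ω | c ω < t} := fun t => measurableSet_lt hcm measurable_const
  -- The threshold is taken for the cost measure, since it is the cost that must come to `B`.
  obtain ⟨θ, h1, h2⟩ := exists_threshold (μ.withDensity c) hcm (B := B) (fun t ht => by
      rw [withDensity_apply _ (hlt t)]
      have h1 : ∫⁻ ω in {ω | c ω < t}, c ω ∂μ ≤ ∫⁻ _ in {ω | c ω < t}, t ∂μ :=
        setLIntegral_mono measurable_const fun ω (hω : c ω < t) => hω.le
      refine h1.trans_lt ?_
      rw [setLIntegral_const]
      exact ENNReal.mul_lt_top ht (measure_lt_top _ _)) (by simpa using hB.le)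
  have hθ : θ ≠ ⊤ := by
    rintro rfl
    refine hB.not_ge (le_trans ?_ h1)
    rw [withDensity_apply _ (hlt _)]
    refine le_of_eq ?_
    rw [← setLIntegral_univ]
    refine setLIntegral_congr ?_
    filter_upwards [hfin] with ω hω
    exact propext ⟨fun _ => hω, fun _ => trivial⟩
  have hE : MeasurableSet {ω | c ω = θ} := measurableSet_eq_fun hcm measurable_const
  have hint : ∀ D ⊆ {ω | c ω = θ}, MeasurableSet D →
      μ.withDensity c ({ω | c ω < θ} ∪ D) = μ.withDensity c {ω | c ω < θ} + θ * μ D := by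
    intro D hD hDm
    rw [measure_union _ hDm, withDensity_apply c hDm, setLIntegral_congr_fun hDm
      (g := fun _ => θ) fun ω hω => hD hω, setLIntegral_const]
    exact Set.disjoint_left.2 fun ω h3 h4 => (ne_of_lt h3) (hD h4)
  have hle : {ω | c ω ≤ θ} = {ω | c ω < θ} ∪ {ω | c ω = θ} := by
    ext ω
    simp [le_iff_lt_or_eq]
  rw [hle, hint _ le_rfl hE] at h2
  have hθ0 : θ ≠ 0 := by
    rintro rfl
    exact hB0 (by simpa using h2)
  -- Among the points of cost exactly `θ`, just enough are taken to spend what the cheaper ones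
  -- leave.
  obtain ⟨D, hDE, hDm, hD⟩ := hμ _ hE ((B - μ.withDensity c {ω | c ω < θ}) / θ) (by
    rw [ENNReal.div_le_iff hθ0 hθ, tsub_le_iff_left, mul_comm (μ _)]
    exact h2)
  refine ⟨θ, {ω | c ω < θ} ∪ D, hθ0, hθ, (hlt θ).union hDm,
    Eventually.of_forall fun ω h => Or.inl h,
    Eventually.of_forall fun ω h => h.elim (fun (h' : c ω < θ) => h'.le)
      fun h' => le_of_eq (hDE h' : c ω = θ), ?_⟩
  rw [← withDensity_apply _ ((hlt θ).union hDm), hint D hDE hDm, hD, ENNReal.mul_div_cancel hθ0 hθ,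
    add_tsub_cancel_of_le h1]

namespace IsGreedy

variable {θ : ℝ≥0∞} {A : Set Ω} {x : Ω → ℝ≥0∞}

/-- This is `(θ - c) * (1_A - x) ≥ 0` written without subtraction: on and off `A` the two factors
have the same sign. Here `θ` acts as the Lagrange multiplier of the budget. -/
lemma ae_le (hA : IsGreedy μ c B θ A) (hx1 : ∀ ω, x ω ≤ 1) : ∀ᵐ ω ∂μ,
    θ * x ω + A.indicator c ω ≤ A.indicator (fun _ => θ) ω + x ω * c ω := by
  filter_upwards [hA.mem_of_lt, hA.le_of_mem] with ω h1 h2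
  by_cases hω : ω ∈ A
  · simp only [hω, Set.indicator_of_mem]
    have h3 := h2 hω
    have hθ := hA.ne_top
    have hc := (h3.trans_lt (lt_top_iff_ne_top.2 hθ)).ne
    have hx := ((hx1 ω).trans_lt ENNReal.one_lt_top).ne
    have hx1 := hx1 ω
    lift x ω to ℝ≥0 using hx with y
    lift c ω to ℝ≥0 using hc with b
    lift θ to ℝ≥0 using hθ with t
    norm_cast at *
    have e : (t : ℝ) * y + b ≤ t + y * b := by
      have h4 : (b : ℝ) ≤ t := h3
      have h5 : (y : ℝ) ≤ 1 := hx1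
      nlinarith
    exact_mod_cast e
  · simp only [hω, not_false_eq_true, Set.indicator_of_notMem, add_zero, zero_add]
    rw [mul_comm]
    gcongr
    exact not_lt.1 fun h => hω (h1 h)

lemma lintegral_left (hA : IsGreedy μ c B θ A) (hx : AEMeasurable x μ) :
    ∫⁻ ω, (θ * x ω + A.indicator c ω) ∂μ = θ * ∫⁻ ω, x ω ∂μ + B := by
  rw [lintegral_add_left' (hx.const_mul _), lintegral_const_mul' _ _ hA.ne_top,
    lintegral_indicator hA.measurableSet, hA.cost_eq]

lemma lintegral_right (hA : IsGreedy μ c B θ A) :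
    ∫⁻ ω, (A.indicator (fun _ => θ) ω + x ω * c ω) ∂μ = θ * μ A + ∫⁻ ω, x ω * c ω ∂μ := by
  rw [lintegral_add_left (measurable_const.indicator hA.measurableSet),
    lintegral_indicator hA.measurableSet, setLIntegral_const]

lemma packValue_eq (hA : IsGreedy μ c B θ A) (hB : B ≠ ⊤) : packValue μ c B = μ A := by
  refine le_antisymm (iSup₂_le fun x hx => ?_) ?_
  · have h := lintegral_mono_ae (hA.ae_le hx.le_one)
    rw [hA.lintegral_left hx.aemeasurable, hA.lintegral_right] at h
    have h2 := (ENNReal.add_le_add_iff_right hB).1 (h.trans (add_le_add_right hx.cost_le _))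
    exact (ENNReal.mul_le_mul_iff_right hA.ne_zero hA.ne_top).1 h2
  · have : IsPacking μ c B (A.indicator fun _ => 1) := by
      refine ⟨aemeasurable_const.indicator hA.measurableSet,
        fun ω => Set.indicator_le_self' (fun _ _ => zero_le) ω, le_of_eq ?_⟩
      rw [← hA.cost_eq, ← lintegral_indicator hA.measurableSet]
      refine lintegral_congr fun ω => ?_
      by_cases hω : ω ∈ A <;> simp [hω]
    simpa [hA.measurableSet] using this.lintegral_le

/-- A selection of the greatest possible measure exhausts the budget and takes the cheapest
points. -/
lemma of_lintegral_eq [IsFiniteMeasure μ] (hA : IsGreedy μ c B θ A) (hc : AEMeasurable c μ)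
    (hB : B ≠ ⊤) (hfin : ∀ᵐ ω ∂μ, c ω < ⊤) (hx : IsPacking μ c B x)
    (he : ∫⁻ ω, x ω ∂μ = packValue μ c B) :
    ∫⁻ ω, x ω * c ω ∂μ = B ∧ (∀ᵐ ω ∂μ, c ω < θ → x ω = 1) ∧ ∀ᵐ ω ∂μ, θ < c ω → x ω = 0 := by
  rw [hA.packValue_eq hB] at he
  have hθA : θ * μ A ≠ ⊤ := ENNReal.mul_ne_top hA.ne_top (measure_ne_top _ _)
  have h := lintegral_mono_ae (hA.ae_le hx.le_one)
  rw [hA.lintegral_left hx.aemeasurable, hA.lintegral_right, he] at h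
  have hcost : ∫⁻ ω, x ω * c ω ∂μ = B :=
    le_antisymm hx.cost_le ((ENNReal.add_le_add_iff_left hθA).1 h)
  -- Equal finite integrals turn the pointwise inequality into `(θ - c) * (1_A - x) = 0` almost
  -- everywhere.
  have hae := ae_eq_of_ae_le_of_lintegral_le (hA.ae_le hx.le_one)
    (by
      rw [hA.lintegral_left hx.aemeasurable, he]
      exact ENNReal.add_ne_top.2 ⟨hθA, hB⟩)
    ((measurable_const.indicator hA.measurableSet).aemeasurable.add (hx.aemeasurable.mul hc))
    (by rw [hA.lintegral_left hx.aemeasurable, hA.lintegral_right, he, hcost])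
  refine ⟨hcost, ?_, ?_⟩
  · filter_upwards [hae, hA.mem_of_lt] with ω h1 h2 h3
    have hω := h2 h3
    simp only [hω, Set.indicator_of_mem] at h1
    have hθ := hA.ne_top
    have hcω := h3.ne_top
    have hxω := ((hx.le_one ω).trans_lt ENNReal.one_lt_top).ne
    lift x ω to ℝ≥0 using hxω with y
    lift c ω to ℝ≥0 using hcω with b
    lift θ to ℝ≥0 using hθ with t
    norm_cast at h1 h3 ⊢
    have e : (t : ℝ) * y + b = t + y * b := by exact_mod_cast h1
    have h4 : (b : ℝ) < t := h3
    have : ((t : ℝ) - b) * (y - 1) = 0 := by linarith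
    rcases mul_eq_zero.1 this with h5 | h5
    · linarith
    · exact_mod_cast sub_eq_zero.1 h5
  · filter_upwards [hae, hA.le_of_mem, hfin] with ω h1 h2 h4 h3
    have hω : ω ∉ A := fun h => (h2 h).not_gt h3
    simp only [hω, not_false_eq_true, Set.indicator_of_notMem, add_zero, zero_add] at h1
    by_contra h0
    rw [mul_comm, ENNReal.mul_right_inj h0 ((hx.le_one ω).trans_lt ENNReal.one_lt_top).ne] at h1
    exact h3.ne h1

end IsGreedy

/-- The greatest measure is reached by the selection of a set of cheapest points. -/
lemma exists_set_packValue [IsProbabilityMeasure μ] (hμ : Divisible μ) (hc : AEMeasurable c μ)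
    (hfin : ∀ᵐ ω ∂μ, c ω < ⊤) (hB0 : B ≠ 0) :
    ∃ (θ : ℝ≥0∞) (A : Set Ω), MeasurableSet A ∧ (∀ᵐ ω ∂μ, ω ∈ A → c ω ≤ θ) ∧
      (∀ᵐ ω ∂μ, ω ∉ A → θ ≤ c ω) ∧ ∫⁻ ω in A, c ω ∂μ = min B (∫⁻ ω, c ω ∂μ) ∧
      packValue μ c B = μ A := by
  rcases lt_or_ge B (∫⁻ ω, c ω ∂μ) with hB | hB
  · obtain ⟨θ, A, hA⟩ := exists_isGreedy hμ hc hfin hB0 hB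
    refine ⟨θ, A, hA.measurableSet, hA.le_of_mem, ?_, by rw [hA.cost_eq, min_eq_left hB.le],
      hA.packValue_eq hB.ne_top⟩
    filter_upwards [hA.mem_of_lt] with ω h1 h2
    exact not_lt.1 fun h => h2 (h1 h)
  · exact ⟨⊤, Set.univ, MeasurableSet.univ, by simp, by simp, by simp [hB],
      by simp [packValue_eq_one hB]⟩

end Packing

/-! ### Packing with a two-valued cost -/

lemma one_sub_tsub {u b : ℝ≥0∞} (hu : u ≤ 1) : 1 - (u - b) = min b u + (1 - u) := by
  rcases le_or_gt u b with h | h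
  · rw [tsub_eq_zero_of_le h, min_eq_right h, add_tsub_cancel_of_le hu, tsub_zero]
  · have hu' := (hu.trans_lt ENNReal.one_lt_top).ne
    have hb := h.ne_top
    lift u to ℝ≥0 using hu'
    lift b to ℝ≥0 using hb
    rw [min_eq_left h.le, add_comm]
    norm_cast at *
    exact tsub_tsub_assoc hu h.le

/-- The packing value if all elements of `U` have the same cost and all others are free. -/
lemma packValue_of_const {Ω : Type*} [MeasurableSpace Ω] {μ : Measure Ω} [IsProbabilityMeasure μ]
    {c : Ω → ℝ≥0∞} {B K : ℝ≥0∞} {U : Set Ω} (hU : MeasurableSet U) (hK0 : K ≠ 0) (hK : K ≠ ⊤)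
    (h1 : ∀ᵐ ω ∂μ, ω ∈ U → c ω = K) (h2 : ∀ᵐ ω ∂μ, ω ∉ U → c ω = 0) :
    packValue μ c B = 1 - (μ U - B / K) := by
  have hcost : ∀ x : Ω → ℝ≥0∞, ∫⁻ ω, x ω * c ω ∂μ = (∫⁻ ω in U, x ω ∂μ) * K := by
    intro x
    rw [← lintegral_mul_const' _ _ hK, ← lintegral_indicator hU]
    refine lintegral_congr_ae ?_
    filter_upwards [h1, h2] with ω h1 h2
    by_cases hω : ω ∈ U
    · simp [hω, h1 hω]
    · simp [hω, h2 hω]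
  have hUc : μ Uᶜ = 1 - μ U := prob_compl_eq_one_sub hU
  rw [one_sub_tsub prob_le_one]
  refine le_antisymm (iSup₂_le fun x hx => ?_) ?_
  · rw [← lintegral_add_compl x hU, ← hUc]
    have hle : ∀ s, ∫⁻ ω in s, x ω ∂μ ≤ μ s := fun s => by
      calc ∫⁻ ω in s, x ω ∂μ ≤ ∫⁻ _ in s, 1 ∂μ := lintegral_mono hx.le_one
        _ = μ s := by simp
    refine add_le_add (le_min ?_ (hle U)) (hle _)
    rw [ENNReal.le_div_iff_mul_le (Or.inl hK0) (Or.inl hK), ← hcost]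
    exact hx.cost_le
  -- The affordable fraction of `U`, spread evenly over `U`; the free points are all taken.
  · set t : ℝ≥0∞ := min (B / K / μ U) 1 with ht
    set x : Ω → ℝ≥0∞ := fun ω => U.indicator (fun _ => t) ω + Uᶜ.indicator (fun _ => 1) ω with hx
    have hxU : ∫⁻ ω in U, x ω ∂μ = t * μ U := by
      rw [setLIntegral_congr_fun hU (g := fun _ => t) fun ω hω => by simp [hx, hω],
        setLIntegral_const]
    have hpack : IsPacking μ c B x := by
      refine ⟨?_, fun ω => ?_, ?_⟩
      · exact ((measurable_const.indicator hU).add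
          (measurable_const.indicator hU.compl)).aemeasurable
      · by_cases hω : ω ∈ U <;> simp [hx, hω, ht]
      · rw [hcost, hxU]
        calc t * μ U * K ≤ B / K / μ U * μ U * K := by
              gcongr
              exact min_le_left _ _
          _ ≤ B / K * K := by
              gcongr
              exact (mul_comm _ _).trans_le ENNReal.mul_div_le
          _ ≤ B := (mul_comm _ _).trans_le ENNReal.mul_div_le
    refine le_trans ?_ hpack.lintegral_le
    rw [lintegral_add_left (measurable_const.indicator hU), lintegral_indicator hU,
      lintegral_indicator hU.compl, setLIntegral_const, setLIntegral_const, one_mul, hUc]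
    gcongr
    rcases eq_or_ne (μ U) 0 with h0 | h0
    · simp [h0]
    · rw [ht, min_mul_of_nonneg, ENNReal.div_mul_cancel h0 (measure_ne_top _ _), one_mul]
      exact zero_le

/-! ### Standing assumptions and measurability -/

namespace Game

/-- The standing assumptions on the game. -/
structure Proper (G : Game M) : Prop where
  card_pos : 0 < M
  absolutelyContinuous : G.law ≪ volume
  ae_nonneg : ∀ᵐ h ∂G.law, ∀ m, 0 ≤ h m
  noise_pos : 0 < G.noise
  rate_pos : 0 < G.rate
  txBudget_pos : 0 < G.txBudget
  jamBudget_pos : 0 < G.jamBudget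

variable {G : Game M}

lemma Proper.ae_pos (hG : G.Proper) : ∀ᵐ h ∂G.law, ∀ m, 0 < h m := by
  have h1 : ∀ᵐ h ∂G.law, ∀ m, h m ≠ 0 := by
    refine ae_all_iff.2 fun m => ?_
    rw [ae_iff]
    refine hG.absolutelyContinuous ?_
    simp only [ne_eq, not_not]
    rw [volume_pi]
    exact Measure.pi_hyperplane _ _ _
  filter_upwards [hG.ae_nonneg, h1] with h h2 h3 m
  exact lt_of_le_of_ne (h2 m) (h3 m).symm

lemma Proper.divisible (hG : G.Proper) [IsProbabilityMeasure G.law] : Divisible G.law :=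
  divisible_of_absolutelyContinuous hG.card_pos _ hG.absolutelyContinuous

lemma measurable_frameAvg : Measurable (frameAvg : Alloc M → ℝ≥0) := continuous_frameAvg.measurable

lemma Proper.aemeasurable_jamCost (hG : G.Proper) {T : Strategy M} (hT : Measurable T) :
    AEMeasurable (fun h => G.jamCost h (T h)) G.law := by
  refine (measurable_jamCostSeq (G := G) hT).aemeasurable.congr ?_
  filter_upwards [hG.ae_pos] with h hh
  exact (jamCost_eq_jamCostSeq hG.card_pos hG.noise_pos hG.rate_pos hh _).symm

lemma Proper.aemeasurable_requiredTx (hG : G.Proper) {K : ℝ≥0} (hK : 0 < K) :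
    AEMeasurable (G.requiredTx K) G.law := by
  refine (measurable_requiredTxSeq (G := G) K).aemeasurable.congr ?_
  filter_upwards [hG.ae_pos] with h hh
  exact (requiredTx_eq_requiredTxSeq hG.card_pos hG.noise_pos hG.rate_pos hh hK).symm

lemma measurableSet_outage {T J : Strategy M} (hT : Measurable T) (hJ : Measurable J) :
    MeasurableSet {h | G.mutualInfo h (T h) (J h) < G.rate} := by
  refine measurableSet_lt ?_ measurable_const
  unfold mutualInfo
  refine measurable_const.mul (Finset.measurable_sum _ fun m _ => Real.measurable_log.comp ?_)
  refine measurable_const.add (Measurable.div ?_ (measurable_const.add ?_))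
  · exact (measurable_pi_apply m).mul ((measurable_pi_apply m).comp hT).coe_nnreal_real
  · exact ((measurable_pi_apply m).comp hJ).coe_nnreal_real

/-! ### The best answer of the jammer -/

lemma outage_le_packValue {T J : Strategy M} (hT : Measurable T)
    (hJ : G.JamAdmissible J) :
    G.outage T J ≤ packValue G.law (fun h => G.jamCost h (T h)) G.jamBudget := by
  have hO := measurableSet_outage (G := G) hT hJ.1
  have : IsPacking G.law (fun h => G.jamCost h (T h)) G.jamBudget
      ({h | G.mutualInfo h (T h) (J h) < G.rate}.indicator fun _ => 1) := by
    refine ⟨(measurable_const.indicator hO).aemeasurable,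
      fun ω => Set.indicator_le_self' (fun _ _ => zero_le) ω, le_trans (lintegral_mono ?_) hJ.2⟩
    intro h
    by_cases hh : G.mutualInfo h (T h) (J h) < G.rate
    · simpa [hh] using jamCost_le hh.le
    · simp [hh]
  simpa [hO, outage] using this.lintegral_le

/-- The slack in the budget pays for choosing jamming from a dense sequence and for getting strictly
under the rate. -/
lemma Proper.exists_jamAdmissible (hG : G.Proper) {T : Strategy M}
    (hT : Measurable T) {A : Set (Fin M → ℝ)} (hA : MeasurableSet A) [IsProbabilityMeasure G.law]
    (hcost : ∫⁻ h in A, G.jamCost h (T h) ∂G.law < G.jamBudget) :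
    ∃ J, G.JamAdmissible J ∧ G.law A ≤ G.outage T J := by
  classical
  set q := TopologicalSpace.denseSeq (Alloc M) with hq
  set ε : ℝ≥0∞ := G.jamBudget - ∫⁻ h in A, G.jamCost h (T h) ∂G.law with hε
  have hε0 : ε ≠ 0 := (tsub_pos_of_lt hcost).ne'
  obtain ⟨N, hN1, hN2⟩ := exists_measurable_index (good := fun n (h : Fin M → ℝ) =>
      G.mutualInfo h (T h) (q n) < G.rate ∧ (frameAvg (q n) : ℝ≥0∞) < G.jamCostSeq h (T h) + ε)
    fun n => (measurableSet_lt (measurable_mutualInfo_strategy T hT _) measurable_const).inter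
      (measurableSet_lt measurable_const ((measurable_jamCostSeq hT).add measurable_const))
  have hgood : ∀ᵐ h ∂G.law, G.mutualInfo h (T h) (q (N h)) < G.rate ∧
      (frameAvg (q (N h)) : ℝ≥0∞) ≤ G.jamCost h (T h) + ε := by
    filter_upwards [hG.ae_pos] with h hh
    rw [jamCost_eq_jamCostSeq hG.card_pos hG.noise_pos hG.rate_pos hh]
    refine (hN2 h ?_).imp_right le_of_lt
    rw [← jamCost_eq_jamCostSeq hG.card_pos hG.noise_pos hG.rate_pos hh]
    exact exists_denseSeq_of_jamCost_lt hG.card_pos hG.noise_pos hG.rate_pos hh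
      (ENNReal.lt_add_right (jamCost_lt_top hG.card_pos hG.noise_pos hG.rate_pos hh _).ne hε0)
  refine ⟨A.indicator fun h => q (N h), ⟨?_, ?_⟩, ?_⟩
  · exact ((measurable_from_top (f := q)).comp hN1).indicator hA
  · have h1 : G.avgPower (A.indicator fun h => q (N h)) =
        ∫⁻ h in A, (frameAvg (q (N h)) : ℝ≥0∞) ∂G.law := by
      rw [avgPower, ← lintegral_indicator hA]
      refine lintegral_congr fun h => ?_
      by_cases hh : h ∈ A <;> simp [hh]
    rw [h1]
    calc ∫⁻ h in A, (frameAvg (q (N h)) : ℝ≥0∞) ∂G.law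
        ≤ ∫⁻ h in A, (G.jamCost h (T h) + ε) ∂G.law :=
          lintegral_mono_ae (ae_restrict_of_ae (hgood.mono fun _ h => h.2))
      _ = ∫⁻ h in A, G.jamCost h (T h) ∂G.law + ε * G.law A := by
          rw [lintegral_add_right _ measurable_const, setLIntegral_const]
      _ ≤ ∫⁻ h in A, G.jamCost h (T h) ∂G.law + ε * 1 := by
          gcongr
          exact prob_le_one
      _ = G.jamBudget := by rw [mul_one, hε, add_tsub_cancel_of_le hcost.le]
  · refine measure_mono_ae ?_
    filter_upwards [hgood] with h hh hA
    have hA' : h ∈ A := hA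
    show G.mutualInfo h (T h) (A.indicator (fun h => q (N h)) h) < G.rate
    rw [Set.indicator_of_mem hA']
    exact hh.1

lemma worstOutage_le_one [IsProbabilityMeasure G.law] (T : Strategy M) : G.worstOutage T ≤ 1 :=
  iSup₂_le fun _ _ => prob_le_one

/-- The jammer makes the cheapest frames fail, until the power budget is exhausted. -/
lemma Proper.worstOutage_eq (hG : G.Proper) [IsProbabilityMeasure G.law] {T : Strategy M}
    (hT : Measurable T) :
    G.worstOutage T = packValue G.law (fun h => G.jamCost h (T h)) G.jamBudget := by
  refine le_antisymm (iSup₂_le fun J hJ => outage_le_packValue hT hJ) ?_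
  have hfin : ∀ᵐ h ∂G.law, G.jamCost h (T h) < ⊤ := by
    filter_upwards [hG.ae_pos] with h hh
    exact jamCost_lt_top hG.card_pos hG.noise_pos hG.rate_pos hh _
  -- A strict budget inequality is required, so the jammer packs against the budget divided by `a`;
  -- this loses at most a factor `a`, and `a` tends to 1.
  have hscale : ∀ a : ℝ≥0, 1 < a →
      packValue G.law (fun h => G.jamCost h (T h)) G.jamBudget ≤ a * G.worstOutage T := by
    intro a ha
    have ha0 : a ≠ 0 := (one_pos.trans ha).ne'
    have hJ0 := hG.jamBudget_pos
    refine (packValue_le_mul_budget ha.le).trans (mul_le_mul_right ?_ _)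
    have hb : ((a : ℝ≥0∞)⁻¹ * G.jamBudget) < G.jamBudget := by
      rw [← ENNReal.coe_inv ha0, ← ENNReal.coe_mul, ENNReal.coe_lt_coe]
      exact mul_lt_of_lt_one_left hJ0 (inv_lt_one_of_one_lt₀ ha)
    obtain ⟨θ, A, hA, -, -, hcost, hval⟩ := exists_set_packValue hG.divisible
      (hG.aemeasurable_jamCost hT) hfin (B := (a : ℝ≥0∞)⁻¹ * G.jamBudget) (by simp [hJ0.ne'])
    rw [hval]
    obtain ⟨J, hJ, hle⟩ := hG.exists_jamAdmissible hT hA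
      ((hcost.le.trans (min_le_left _ _)).trans_lt hb)
    exact hle.trans (le_iSup₂ (f := fun J (_ : G.JamAdmissible J) => G.outage T J) J hJ)
  have hl : Tendsto (fun a : ℝ≥0 => (a : ℝ≥0∞) * G.worstOutage T) (𝓝[>] 1)
      (𝓝 (G.worstOutage T)) := by
    have h1 : Tendsto (fun a : ℝ≥0 => (a : ℝ≥0∞)) (𝓝[>] 1) (𝓝 ((1 : ℝ≥0) : ℝ≥0∞)) :=
      (ENNReal.continuous_coe.tendsto 1).mono_left nhdsWithin_le_nhds
    simpa using ENNReal.Tendsto.mul_const h1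
      (Or.inr ((worstOutage_le_one T).trans_lt ENNReal.one_lt_top).ne)
  exact ge_of_tendsto hl (eventually_nhdsWithin_of_forall hscale)

/-! ### Level strategies -/

/-- The greatest probability of frames on which the transmitter can reach the level `K`. -/
noncomputable def coverage (G : Game M) (K : ℝ≥0) : ℝ≥0∞ :=
  packValue G.law (G.requiredTx K) G.txBudget

/-- The jammer faces cost `K` on the used frames and cost 0 elsewhere, a knapsack with an explicit
value. -/
lemma IsLevelStrategy.worstOutage_eq (hG : G.Proper) [IsProbabilityMeasure G.law] {K : ℝ≥0}
    (hK : 0 < K) {T : Strategy M} (hT : Measurable T) (hL : G.IsLevelStrategy K T) :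
    G.worstOutage T = 1 - (G.law {h | T h ≠ 0} - (G.jamBudget : ℝ≥0∞) / (K : ℝ≥0∞)) := by
  rw [hG.worstOutage_eq hT]
  obtain ⟨θ, hθ⟩ := hL
  refine packValue_of_const ?_ (by exact_mod_cast hK.ne') ENNReal.coe_ne_top ?_ ?_
  · exact (hT (measurableSet_singleton 0)).compl
  · filter_upwards [hθ] with h hh (hne : T h ≠ 0)
    exact (hh.resolve_right fun h0 => hne h0.1).2.1
  · filter_upwards with h hh
    have : T h = 0 := not_not.1 hh
    rw [this, jamCost_zero hG.rate_pos]

lemma IsLevelStrategy.measure_le_coverage {K : ℝ≥0}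
    {T : Strategy M} (hT : G.TxAdmissible T) (hL : G.IsLevelStrategy K T) :
    G.law {h | T h ≠ 0} ≤ G.coverage K := by
  have hU : MeasurableSet {h | T h ≠ 0} := (hT.1 (measurableSet_singleton 0)).compl
  have : IsPacking G.law (G.requiredTx K) G.txBudget ({h | T h ≠ 0}.indicator fun _ => 1) := by
    refine ⟨(measurable_const.indicator hU).aemeasurable,
      fun ω => Set.indicator_le_self' (fun _ _ => zero_le) ω, le_trans (lintegral_mono_ae ?_) hT.2⟩
    obtain ⟨θ, hθ⟩ := hL
    filter_upwards [hθ] with h hh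
    by_cases h0 : T h = 0
    · simp [h0]
    · simp [h0, (hh.resolve_right fun h1 => h0 h1.1).1]
  simpa [hU, coverage] using this.lintegral_le

lemma Proper.ae_requiredTx_lt_top (hG : G.Proper) (K : ℝ≥0) :
    ∀ᵐ h ∂G.law, G.requiredTx K h < ⊤ := by
  filter_upwards [hG.ae_pos] with h hh
  exact requiredTx_lt_top hG.card_pos hG.noise_pos hh K

/-- The level strategy that serves as many frames as the power budget allows. -/
lemma Proper.exists_isLevelStrategy (hG : G.Proper) [IsProbabilityMeasure G.law] {K : ℝ≥0}
    (hK : 0 < K) : ∃ T, G.TxAdmissible T ∧ G.IsLevelStrategy K T ∧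
      G.law {h | T h ≠ 0} = G.coverage K ∧
      G.avgPower T = min (G.txBudget : ℝ≥0∞) (∫⁻ h, G.requiredTx K h ∂G.law) := by
  classical
  obtain ⟨θ, A, hA, hle, hge, hcost, hval⟩ := exists_set_packValue hG.divisible
    (hG.aemeasurable_requiredTx hK) (hG.ae_requiredTx_lt_top K) (B := G.txBudget)
    (by exact_mod_cast hG.txBudget_pos.ne')
  obtain ⟨T, hTm, hT⟩ := exists_measurable_isLevelAlloc hG.card_pos hG.noise_pos hG.rate_pos hK
  have hlev : ∀ᵐ h ∂G.law, G.jamCost h (T h) = K ∧ (frameAvg (T h) : ℝ≥0∞) = G.requiredTx K h := by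
    filter_upwards [hG.ae_pos] with h hh
    exact ⟨(hT h hh).jamCost_eq hG.card_pos hG.noise_pos hG.rate_pos hh, (hT h hh).2⟩
  have hTA : Measurable (A.indicator T) := hTm.indicator hA
  have hpow : G.avgPower (A.indicator T) =
      min (G.txBudget : ℝ≥0∞) (∫⁻ h, G.requiredTx K h ∂G.law) := by
    rw [← hcost, avgPower, ← lintegral_indicator hA]
    refine lintegral_congr_ae ?_
    filter_upwards [hlev] with h hh
    by_cases hhA : h ∈ A <;> simp [hhA, hh.2]
  refine ⟨A.indicator T, ⟨hTA, hpow ▸ min_le_left _ _⟩, ⟨θ, ?_⟩, ?_, hpow⟩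
  · filter_upwards [hlev, hle, hge] with h h1 h2 h3
    by_cases hhA : h ∈ A
    · left
      rw [Set.indicator_of_mem hhA]
      exact ⟨h1.2, h1.1, h2 hhA⟩
    · exact Or.inr ⟨Set.indicator_of_notMem hhA _, h3 hhA⟩
  · rw [coverage, hval]
    refine measure_congr ?_
    filter_upwards [hlev] with h h1
    refine propext ?_
    show A.indicator T h ≠ 0 ↔ h ∈ A
    by_cases hhA : h ∈ A
    · rw [Set.indicator_of_mem hhA]
      refine ⟨fun _ => hhA, fun _ h0 => hK.ne' ?_⟩
      rw [h0, jamCost_zero hG.rate_pos] at h1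
      exact_mod_cast h1.1.symm
    · simp [hhA]

lemma Proper.levelOutage_eq (hG : G.Proper) [IsProbabilityMeasure G.law] {K : ℝ≥0}
    (hK : 0 < K) :
    G.levelOutage K = 1 - (G.coverage K - (G.jamBudget : ℝ≥0∞) / (K : ℝ≥0∞)) := by
  refine le_antisymm ?_ ?_
  · obtain ⟨T, hT, hL, hU, -⟩ := hG.exists_isLevelStrategy hK
    rw [← hU, ← hL.worstOutage_eq hG hK hT.1]
    exact iInf_le_of_le T (iInf₂_le hT hL)
  · refine le_iInf fun T => le_iInf₂ fun hT hL => ?_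
    rw [hL.worstOutage_eq hG hK hT.1]
    exact tsub_le_tsub_left (tsub_le_tsub_right (hL.measure_le_coverage hT) _) _

/-! ### The dependence on the level -/

lemma coverage_le_one [IsProbabilityMeasure G.law] (K : ℝ≥0) : G.coverage K ≤ 1 :=
  packValue_le_one

lemma coverage_ne_top [IsProbabilityMeasure G.law] (K : ℝ≥0) : G.coverage K ≠ ⊤ :=
  ((coverage_le_one K).trans_lt ENNReal.one_lt_top).ne

lemma coverage_anti {K K' : ℝ≥0} (h : K ≤ K') : G.coverage K' ≤ G.coverage K :=
  packValue_anti (Eventually.of_forall fun _ => requiredTx_mono h)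

lemma Proper.coverage_le_mul (hG : G.Proper) {K a : ℝ≥0} (hK : 0 < K) (ha : 1 ≤ a) :
    G.coverage K ≤ a * G.coverage (a * K) := by
  refine packValue_le_mul ha ?_
  filter_upwards [hG.ae_pos] with h hh
  exact requiredTx_mul_le hG.card_pos hG.noise_pos hG.rate_pos hh hK ha

/-- The guaranteed probability of success with level `K`, if it is nonnegative. -/
noncomputable def gain (G : Game M) (K : ℝ≥0) : ℝ :=
  (G.coverage K).toReal - G.jamBudget / K

lemma Proper.levelOutage_eq_gain (hG : G.Proper) [IsProbabilityMeasure G.law] {K : ℝ≥0}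
    (hK : 0 < K) : G.levelOutage K = 1 - ENNReal.ofReal (G.gain K) := by
  rw [hG.levelOutage_eq hK, gain, ENNReal.ofReal_sub _ (by positivity),
    ENNReal.ofReal_toReal (coverage_ne_top K), ← NNReal.coe_div, ENNReal.ofReal_coe_nnreal,
    ENNReal.coe_div hK.ne']

lemma gain_le_one [IsProbabilityMeasure G.law] (K : ℝ≥0) : G.gain K ≤ 1 := by
  have h1 : (G.coverage K).toReal ≤ 1 := ENNReal.toReal_mono ENNReal.one_ne_top (coverage_le_one K)
  have h2 : (0 : ℝ) ≤ G.jamBudget / K := by positivity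
  unfold gain
  linarith

lemma gain_nonpos [IsProbabilityMeasure G.law] {K : ℝ≥0} (hK : 0 < K) (h : K ≤ G.jamBudget) :
    G.gain K ≤ 0 := by
  have h1 : (G.coverage K).toReal ≤ 1 := ENNReal.toReal_mono ENNReal.one_ne_top (coverage_le_one K)
  have h2 : (1 : ℝ) ≤ G.jamBudget / K := (one_le_div (by exact_mod_cast hK)).2 (by exact_mod_cast h)
  unfold gain
  linarith

/-- The coverage is antitone in `K` while `K * coverage K` is monotone at positive levels, which
squeezes the coverage near `K`. -/
lemma Proper.continuousAt_gain (hG : G.Proper) [IsProbabilityMeasure G.law] {K : ℝ≥0}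
    (hK : 0 < K) : ContinuousAt G.gain K := by
  have hreal : ∀ {K a : ℝ≥0}, 0 < K → 1 ≤ a →
      (G.coverage K).toReal ≤ a * (G.coverage (a * K)).toReal := by
    intro K a hK ha
    have := ENNReal.toReal_mono (ENNReal.mul_ne_top ENNReal.coe_ne_top (coverage_ne_top _))
      (hG.coverage_le_mul hK ha)
    simpa using this
  have hanti : ∀ {K K' : ℝ≥0}, K ≤ K' → (G.coverage K').toReal ≤ (G.coverage K).toReal :=
    fun h => ENNReal.toReal_mono (coverage_ne_top _) (coverage_anti h)
  have hK' : (K : ℝ) ≠ 0 := by exact_mod_cast hK.ne'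
  have hc : ContinuousAt (fun L : ℝ≥0 => (K : ℝ) / L) K :=
    continuousAt_const.div NNReal.continuous_coe.continuousAt hK'
  have hbound : ∀ᶠ L : ℝ≥0 in 𝓝 K,
      min 1 ((K : ℝ) / L) * (G.coverage K).toReal ≤ (G.coverage L).toReal ∧
        (G.coverage L).toReal ≤ max 1 ((K : ℝ) / L) * (G.coverage K).toReal := by
    filter_upwards [lt_mem_nhds hK] with L hL
    have hL' : (0 : ℝ) < L := by exact_mod_cast hL
    have hKp : (0 : ℝ) < K := by exact_mod_cast hK
    have h0 : ∀ L, 0 ≤ (G.coverage L).toReal := fun _ => ENNReal.toReal_nonneg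
    rcases le_total K L with h | h
    · have h1 := hreal hK ((one_le_div₀ hK).2 h)
      rw [div_mul_cancel₀ _ hK.ne', NNReal.coe_div] at h1
      constructor
      · calc min 1 ((K : ℝ) / L) * (G.coverage K).toReal
            ≤ (K : ℝ) / L * ((L : ℝ) / K * (G.coverage L).toReal) := by
              gcongr
              exact min_le_right _ _
          _ = (G.coverage L).toReal := by field_simp
      · calc (G.coverage L).toReal ≤ 1 * (G.coverage K).toReal := by
              rw [one_mul]
              exact hanti h
          _ ≤ _ := by
              gcongr
              exact le_max_left _ _
    · have h1 := hreal hL ((one_le_div₀ hL).2 h)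
      rw [div_mul_cancel₀ _ hL.ne', NNReal.coe_div] at h1
      constructor
      · calc min 1 ((K : ℝ) / L) * (G.coverage K).toReal ≤ 1 * (G.coverage K).toReal := by
              gcongr
              exact min_le_left _ _
          _ ≤ _ := by
              rw [one_mul]
              exact hanti h
      · refine h1.trans ?_
        gcongr
        exact le_max_right _ _
  have hX : ContinuousAt (fun L => (G.coverage L).toReal) K := by
    have e : (K : ℝ) / K = 1 := div_self hK'
    refine tendsto_of_tendsto_of_tendsto_of_le_of_le'
      (g := fun L : ℝ≥0 => min 1 ((K : ℝ) / L) * (G.coverage K).toReal)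
      (h := fun L : ℝ≥0 => max 1 ((K : ℝ) / L) * (G.coverage K).toReal) ?_ ?_
      (hbound.mono fun _ h => h.1) (hbound.mono fun _ h => h.2)
    · have : ContinuousAt (fun L : ℝ≥0 => min 1 ((K : ℝ) / L) * (G.coverage K).toReal) K :=
        (continuousAt_const.min hc).mul continuousAt_const
      simpa [ContinuousAt, e] using this
    · have : ContinuousAt (fun L : ℝ≥0 => max 1 ((K : ℝ) / L) * (G.coverage K).toReal) K :=
        (continuousAt_const.max hc).mul continuousAt_const
      simpa [ContinuousAt, e] using this
  exact hX.sub (continuousAt_const.div NNReal.continuous_coe.continuousAt hK')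

/-- High levels can be reached on few frames only. -/
lemma Proper.exists_coverage_lt (hG : G.Proper) [IsProbabilityMeasure G.law] {η : ℝ≥0}
    (hη : 0 < η) : ∃ K₀ : ℝ≥0, ∀ K, K₀ < K → G.coverage K < η := by
  set S : (Fin M → ℝ) → ℝ := fun h => ∑ m, h m with hS
  have hSm : Measurable S := Finset.measurable_sum _ fun m _ => measurable_pi_apply m
  have hlim : Tendsto (fun n : ℕ => G.law {h | (n : ℝ) < S h}) atTop (𝓝 0) := by
    have h1 : ⋂ n : ℕ, {h | (n : ℝ) < S h} = ∅ := by
      refine Set.eq_empty_of_forall_notMem fun h hh => ?_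
      obtain ⟨n, hn⟩ := exists_nat_gt (S h)
      have h2 : (n : ℝ) < S h := Set.mem_iInter.1 hh n
      exact hn.not_gt h2
    have := tendsto_measure_iInter_atTop (μ := G.law) (s := fun n : ℕ => {h | (n : ℝ) < S h})
      (fun n => (measurableSet_lt measurable_const hSm).nullMeasurableSet)
      (fun m n hmn h (hh : (n : ℝ) < S h) =>
        show (m : ℝ) < S h from lt_of_le_of_lt (by exact_mod_cast hmn) hh)
      ⟨0, measure_ne_top _ _⟩
    rwa [h1, measure_empty] at this
  obtain ⟨n, hn⟩ := (hlim.eventually_lt_const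
    (show (0 : ℝ≥0∞) < (η / 2 : ℝ≥0) by exact_mod_cast half_pos hη)).exists
  set ρ : ℝ≥0 := G.rate.toNNReal with hρ
  have hρ0 : 0 < ρ := by simpa [hρ] using hG.rate_pos
  -- Above this level the budget covers frames with `S h ≤ n` of measure at most `η / 2`, as each is
  -- expensive; the frames with `S h > n` have measure below `η / 2`.
  refine ⟨2 * n * G.txBudget / (ρ * η), fun K hK => ?_⟩
  have hK0 : 0 < K := lt_of_le_of_lt zero_le hK
  have hsmall : (n : ℝ≥0) / (K * ρ) * G.txBudget ≤ η / 2 := by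
    rw [div_lt_iff₀ (by positivity)] at hK
    rw [div_mul_eq_mul_div, div_le_div_iff₀ (by positivity) two_pos]
    calc (n : ℝ≥0) * G.txBudget * 2 = 2 * n * G.txBudget := by ring
      _ ≤ K * (ρ * η) := hK.le
      _ = η * (K * ρ) := by ring
  have hbound : G.coverage K ≤ G.law {h | (n : ℝ) < S h} +
      ((n : ℝ≥0) / (K * ρ) : ℝ≥0) * G.txBudget := by
    refine iSup₂_le fun x hx => ?_
    have hU : MeasurableSet {h | (n : ℝ) < S h} := measurableSet_lt measurable_const hSm
    have hpt : ∀ᵐ h ∂G.law, x h ≤ {h | (n : ℝ) < S h}.indicator (fun _ => 1) h +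
        ((n : ℝ≥0) / (K * ρ) : ℝ≥0) * (x h * G.requiredTx K h) := by
      filter_upwards [hG.ae_pos] with h hh
      by_cases hn : (n : ℝ) < S h
      · rw [Set.indicator_of_mem (show h ∈ {h | (n : ℝ) < S h} from hn)]
        exact (hx.le_one h).trans le_self_add
      · rw [Set.indicator_of_notMem (show h ∉ {h | (n : ℝ) < S h} from hn), zero_add]
        have h1 := mul_rate_le_requiredTx hG.card_pos hG.noise_pos hG.rate_pos hh hK0
        have h2 : ((K * ρ : ℝ≥0) : ℝ≥0∞) ≤ n * G.requiredTx K h := by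
          rw [ENNReal.coe_mul]
          refine h1.trans ?_
          gcongr
          exact (ENNReal.ofReal_le_ofReal (not_lt.1 hn)).trans_eq (ENNReal.ofReal_natCast n)
        have hKρ : ((K * ρ : ℝ≥0) : ℝ≥0∞) ≠ 0 := by exact_mod_cast (mul_pos hK0 hρ0).ne'
        have h3 : 1 ≤ ((n : ℝ≥0) / (K * ρ) : ℝ≥0) * G.requiredTx K h := by
          rw [ENNReal.coe_div (mul_pos hK0 hρ0).ne', ENNReal.div_eq_inv_mul, mul_assoc,
            ← ENNReal.inv_mul_cancel hKρ ENNReal.coe_ne_top]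
          gcongr
          simpa using h2
        calc x h = x h * 1 := (mul_one _).symm
          _ ≤ x h * (((n : ℝ≥0) / (K * ρ) : ℝ≥0) * G.requiredTx K h) := by gcongr
          _ = _ := by ring
    refine (lintegral_mono_ae hpt).trans ?_
    rw [lintegral_add_left (measurable_const.indicator hU), lintegral_indicator hU,
      setLIntegral_const, one_mul, lintegral_const_mul' _ _ ENNReal.coe_ne_top]
    gcongr
    exact hx.cost_le
  calc G.coverage K ≤ _ := hbound
    _ < (η / 2 : ℝ≥0) + (η / 2 : ℝ≥0) := by
      refine ENNReal.add_lt_add_of_lt_of_le ?_ hn ?_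
      · rw [← ENNReal.coe_mul]
        exact ENNReal.coe_ne_top
      · rw [← ENNReal.coe_mul]
        exact_mod_cast hsmall
    _ = η := by rw [← ENNReal.coe_add, add_halves]

lemma txBudget_lt_lintegral_requiredTx [IsProbabilityMeasure G.law] {K : ℝ≥0}
    (h : G.coverage K < 1) : (G.txBudget : ℝ≥0∞) < ∫⁻ h, G.requiredTx K h ∂G.law := by
  by_contra! hle
  exact h.ne (packValue_eq_one hle)

/-! ### Arbitrary transmitter strategies compared with level strategies -/

/-- The fraction of the level `K` that is reached. -/
noncomputable def levelFraction (G : Game M) (K : ℝ≥0) (T : Strategy M) (h : Fin M → ℝ) : ℝ≥0∞ :=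
  min (G.jamCost h (T h) / K) 1

lemma Proper.isPacking_levelFraction (hG : G.Proper) {K : ℝ≥0} (hK : 0 < K) {T : Strategy M}
    (hT : G.TxAdmissible T) :
    IsPacking G.law (G.requiredTx K) G.txBudget (G.levelFraction K T) where
  aemeasurable := ((hG.aemeasurable_jamCost hT.1).div_const _).min aemeasurable_const
  le_one _ := min_le_right _ _
  cost_le := by
    refine le_trans (lintegral_mono_ae ?_) hT.2
    filter_upwards [hG.ae_pos] with h hh
    exact min_mul_requiredTx_le hG.noise_pos hh hK _

/-- The level is the threshold of the jammer's greedy set `A`. On `A` the fraction is `jamCost / K`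
and integrates to `jamBudget / K`; off `A` it is 1 and integrates to the success probability. -/
lemma Proper.exists_levelFraction_eq (hG : G.Proper) [IsProbabilityMeasure G.law]
    {T : Strategy M} (hT : G.TxAdmissible T) (h : G.worstOutage T < 1) : ∃ K : ℝ≥0, 0 < K ∧
      1 - (G.worstOutage T).toReal =
        (∫⁻ h, G.levelFraction K T h ∂G.law).toReal - G.jamBudget / K := by
  rw [hG.worstOutage_eq hT.1] at h ⊢
  have hB : (G.jamBudget : ℝ≥0∞) < ∫⁻ h, G.jamCost h (T h) ∂G.law := by
    by_contra! hle
    exact h.ne (packValue_eq_one hle)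
  obtain ⟨κ, A, hA⟩ := exists_isGreedy hG.divisible (hG.aemeasurable_jamCost hT.1)
    (by
      filter_upwards [hG.ae_pos] with h hh
      exact jamCost_lt_top hG.card_pos hG.noise_pos hG.rate_pos hh _)
    (by exact_mod_cast hG.jamBudget_pos.ne') hB
  have hκ := hA.ne_top
  lift κ to ℝ≥0 using hκ with K
  have hK0 : K ≠ 0 := by exact_mod_cast hA.ne_zero
  refine ⟨K, pos_of_ne_zero hK0, ?_⟩
  have h1 : ∫⁻ h in A, G.levelFraction K T h ∂G.law = (G.jamBudget / K : ℝ≥0) := by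
    rw [ENNReal.coe_div hK0, ← hA.cost_eq, div_eq_mul_inv, ← lintegral_mul_const' _ _
      (by simpa using hK0)]
    refine lintegral_congr_ae ((ae_restrict_iff' hA.measurableSet).2 ?_)
    filter_upwards [hA.le_of_mem] with h hle hh
    rw [levelFraction, min_eq_left, div_eq_mul_inv]
    exact ENNReal.div_le_of_le_mul (by simpa using hle hh)
  have h2 : ∫⁻ h in Aᶜ, G.levelFraction K T h ∂G.law = G.law Aᶜ := by
    rw [← setLIntegral_one]
    refine lintegral_congr_ae ((ae_restrict_iff' hA.measurableSet.compl).2 ?_)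
    filter_upwards [hA.mem_of_lt] with h hlt hh
    rw [levelFraction, min_eq_right]
    rw [ENNReal.le_div_iff_mul_le (Or.inl hA.ne_zero) (Or.inl ENNReal.coe_ne_top), one_mul]
    exact not_lt.1 fun hc => hh (hlt hc)
  rw [← lintegral_add_compl _ hA.measurableSet, h1, h2, hA.packValue_eq ENNReal.coe_ne_top,
    ENNReal.toReal_add ENNReal.coe_ne_top (measure_ne_top _ _), prob_compl_eq_one_sub
    hA.measurableSet, ENNReal.toReal_sub_of_le prob_le_one ENNReal.one_ne_top]
  simp

lemma Proper.levelFraction_le_gain (hG : G.Proper) [IsProbabilityMeasure G.law] {K : ℝ≥0}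
    (hK : 0 < K) {T : Strategy M} (hT : G.TxAdmissible T) :
    (∫⁻ h, G.levelFraction K T h ∂G.law).toReal - G.jamBudget / K ≤ G.gain K :=
  sub_le_sub_right (ENNReal.toReal_mono (coverage_ne_top K)
    (hG.isPacking_levelFraction hK hT).lintegral_le) _

/-- If the level `K` has the greatest gain, then a strategy that reaches as much of it as possible
is a level strategy with full power. -/
lemma Proper.isLevelStrategy_of_lintegral_eq (hG : G.Proper) [IsProbabilityMeasure G.law] {K : ℝ≥0}
    (hK : 0 < K) (hmax : ∀ L, 0 < L → G.gain L ≤ G.gain K) {T : Strategy M}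
    (hT : G.TxAdmissible T) (he : ∫⁻ h, G.levelFraction K T h ∂G.law = G.coverage K) :
    G.avgPower T = G.txBudget ∧ G.IsLevelStrategy K T := by
  have hx := hG.isPacking_levelFraction hK hT
  have hstruct : ∫⁻ h, G.levelFraction K T h * G.requiredTx K h ∂G.law = G.txBudget ∧
      ∃ θ, (∀ᵐ h ∂G.law, G.requiredTx K h < θ → G.levelFraction K T h = 1) ∧
        ∀ᵐ h ∂G.law, θ < G.requiredTx K h → G.levelFraction K T h = 0 := by
    rcases lt_or_ge (G.txBudget : ℝ≥0∞) (∫⁻ h, G.requiredTx K h ∂G.law) with hB | hB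
    · obtain ⟨θ, A, hA⟩ := exists_isGreedy hG.divisible (hG.aemeasurable_requiredTx hK)
        (hG.ae_requiredTx_lt_top K) (by exact_mod_cast hG.txBudget_pos.ne') hB
      obtain ⟨h1, h2, h3⟩ := hA.of_lintegral_eq (hG.aemeasurable_requiredTx hK)
        ENNReal.coe_ne_top (hG.ae_requiredTx_lt_top K) hx he
      exact ⟨h1, θ, h2, h3⟩
    · have hcov : G.coverage K = 1 := packValue_eq_one hB
      have hone : ∀ᵐ h ∂G.law, G.levelFraction K T h = 1 := by
        refine ae_eq_of_ae_le_of_lintegral_le (Eventually.of_forall hx.le_one) ?_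
          aemeasurable_const ?_
        · rw [he, hcov]
          exact ENNReal.one_ne_top
        · simp [he, hcov]
      have hint : ∫⁻ h, G.levelFraction K T h * G.requiredTx K h ∂G.law =
          ∫⁻ h, G.requiredTx K h ∂G.law :=
        lintegral_congr_ae (hone.mono fun h hh => by simp only [hh, one_mul])
      refine ⟨hint.trans (hB.antisymm ?_), ⊤, hone.mono fun _ h _ => h, by simp⟩
      -- Unspent power would lift all frames to a slightly higher level: the coverage would remain 1
      -- and the loss `jamBudget / K` would shrink, against `hmax`.
      by_contra! hlt
      have hne := hlt.ne_top
      have hl : Tendsto (fun a : ℝ≥0 => (a : ℝ≥0∞) * ∫⁻ h, G.requiredTx K h ∂G.law) (𝓝[>] 1)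
          (𝓝 (∫⁻ h, G.requiredTx K h ∂G.law)) := by
        have h1 : Tendsto (fun a : ℝ≥0 => (a : ℝ≥0∞)) (𝓝[>] 1) (𝓝 ((1 : ℝ≥0) : ℝ≥0∞)) :=
          (ENNReal.continuous_coe.tendsto 1).mono_left nhdsWithin_le_nhds
        simpa using ENNReal.Tendsto.mul_const h1 (Or.inr hne)
      obtain ⟨a, ha, ha1⟩ := ((hl.eventually_lt_const hlt).and self_mem_nhdsWithin).exists
      have ha1' : 1 < a := ha1
      have hcov' : G.coverage (a * K) = 1 := by
        refine packValue_eq_one (le_trans ?_ ha.le)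
        rw [← lintegral_const_mul' _ _ ENNReal.coe_ne_top]
        refine lintegral_mono_ae ?_
        filter_upwards [hG.ae_pos] with h hh
        exact requiredTx_mul_le hG.card_pos hG.noise_pos hG.rate_pos hh hK ha1'.le
      have hgain := hmax (a * K) (mul_pos (one_pos.trans ha1') hK)
      have h1 : (G.jamBudget : ℝ) / (a * K : ℝ≥0) < G.jamBudget / K := by
        have hJ := hG.jamBudget_pos
        refine div_lt_div_of_pos_left (by exact_mod_cast hJ) (by exact_mod_cast hK) ?_
        exact_mod_cast lt_mul_of_one_lt_left hK ha1'
      rw [gain, gain, hcov, hcov'] at hgain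
      linarith
  obtain ⟨hcost, θ, hθ1, hθ2⟩ := hstruct
  have hle : ∀ᵐ h ∂G.law, G.levelFraction K T h * G.requiredTx K h ≤ frameAvg (T h) := by
    filter_upwards [hG.ae_pos] with h hh
    exact min_mul_requiredTx_le hG.noise_pos hh hK _
  have hpow : G.avgPower T = G.txBudget := hT.2.antisymm (hcost ▸ lintegral_mono_ae hle)
  -- Equal finite total powers give equality in `min_mul_requiredTx_le` on almost every frame, which
  -- leaves only empty frames and level allocations.
  have hae := ae_eq_of_ae_le_of_lintegral_le hle (hcost ▸ ENNReal.coe_ne_top)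
    (measurable_frameAvg.comp hT.1).coe_nnreal_ennreal.aemeasurable (hpow.trans hcost.symm).le
  refine ⟨hpow, θ, ?_⟩
  filter_upwards [hG.ae_pos, hae, hθ1, hθ2] with h hh h1 h2 h3
  by_cases h0 : T h = 0
  · refine Or.inr ⟨h0, not_lt.1 fun hlt => ?_⟩
    have := h2 hlt
    simp [levelFraction, h0, jamCost_zero hG.rate_pos] at this
  · have hlev := isLevelAlloc_of_min_mul_requiredTx_eq hG.card_pos hG.noise_pos hG.rate_pos hh h0 h1
    have hcostK := hlev.jamCost_eq hG.card_pos hG.noise_pos hG.rate_pos hh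
    refine Or.inl ⟨hlev.2, hcostK, not_lt.1 fun hlt => ?_⟩
    have h4 := h3 hlt
    rw [levelFraction, hcostK, ENNReal.div_self (by exact_mod_cast hK.ne') ENNReal.coe_ne_top,
      min_self] at h4
    exact one_ne_zero h4

/-! ### The optimal level -/

/-- The level `K` has the greatest gain. -/
def IsBestLevel (G : Game M) (K : ℝ≥0) : Prop :=
  0 < K ∧ 0 < G.gain K ∧ ∀ L, 0 < L → G.gain L ≤ G.gain K

/-- Some gain is positive by comparison with `T`. Competing levels lie between `jamBudget`, up to
which gains are nonpositive, and a level beyond which the coverage is too small; on this compact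
interval the maximum exists. -/
lemma Proper.exists_isBestLevel (hG : G.Proper) [IsProbabilityMeasure G.law]
    {T : Strategy M} (hT : G.TxAdmissible T) (h : G.worstOutage T < 1) :
    ∃ Kmax : ℝ≥0, (∃ K, G.IsBestLevel K) ∧ ∀ K, G.IsBestLevel K → K ≤ Kmax := by
  obtain ⟨κ, hκ, he⟩ := hG.exists_levelFraction_eq hT h
  have hpos : 0 < G.gain κ := by
    refine lt_of_lt_of_le ?_ (hG.levelFraction_le_gain hκ hT)
    rw [← he, sub_pos]
    exact ENNReal.toReal_lt_of_lt_ofReal (by simpa using h)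
  obtain ⟨K₀, hK₀⟩ := hG.exists_coverage_lt (η := (G.gain κ).toNNReal) (by simpa using hpos)
  have hsmall : ∀ K, K₀ < K → G.gain K < G.gain κ := by
    intro K hK
    have h1 : (G.coverage K).toReal < G.gain κ := by
      refine ENNReal.toReal_lt_of_lt_ofReal (hK₀ K hK)
    have h2 : (0 : ℝ) ≤ G.jamBudget / K := by positivity
    have h3 : G.gain K = (G.coverage K).toReal - G.jamBudget / K := rfl
    linarith
  have hmem : ∀ K, 0 < K → G.gain κ ≤ G.gain K → K ∈ Set.Icc G.jamBudget K₀ := by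
    intro K hK hle
    refine ⟨?_, not_lt.1 fun hlt => (hsmall K hlt).not_ge hle⟩
    by_contra! hlt
    exact (hpos.trans_le hle).not_ge (gain_nonpos hK hlt.le)
  obtain ⟨K, hK, hmax⟩ := (isCompact_Icc (a := G.jamBudget) (b := K₀)).exists_isMaxOn
    ⟨κ, hmem κ hκ le_rfl⟩
    fun K hK => (hG.continuousAt_gain (hG.jamBudget_pos.trans_le hK.1)).continuousWithinAt
  have hκK : G.gain κ ≤ G.gain K := hmax (hmem κ hκ le_rfl)
  refine ⟨K₀, ⟨K, hG.jamBudget_pos.trans_le hK.1, hpos.trans_le hκK, fun L hL => ?_⟩,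
    fun L hL => (hmem L hL.1 (hL.2.2 κ hκ)).2⟩
  rcases le_or_gt (G.gain κ) (G.gain L) with hle | hlt
  · exact hmax (hmem L hL hle)
  · exact hlt.le.trans hκK

lemma IsBestLevel.le_worstOutage {K : ℝ≥0} (hK : G.IsBestLevel K) (hG : G.Proper)
    [IsProbabilityMeasure G.law] {T : Strategy M} (hT : G.TxAdmissible T) :
    1 - ENNReal.ofReal (G.gain K) ≤ G.worstOutage T := by
  rcases (worstOutage_le_one (G := G) T).lt_or_eq with h | h
  · obtain ⟨κ, hκ, he⟩ := hG.exists_levelFraction_eq hT h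
    have h1 := (hG.levelFraction_le_gain hκ hT).trans (hK.2.2 κ hκ)
    rw [← he] at h1
    rw [← ENNReal.ofReal_one, ← ENNReal.ofReal_sub _ hK.2.1.le, ← ENNReal.ofReal_toReal h.ne_top]
    exact ENNReal.ofReal_le_ofReal (by linarith)
  · rw [h]
    exact tsub_le_self

lemma IsBestLevel.exists_optimal {K : ℝ≥0} (hK : G.IsBestLevel K) (hG : G.Proper)
    [IsProbabilityMeasure G.law] : ∃ T, G.IsLevelStrategy K T ∧ G.IsMinimaxOptimal T ∧
      G.worstOutage T = 1 - ENNReal.ofReal (G.gain K) := by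
  obtain ⟨T, hT, hL, hU, -⟩ := hG.exists_isLevelStrategy hK.1
  have hout : G.worstOutage T = 1 - ENNReal.ofReal (G.gain K) := by
    rw [hL.worstOutage_eq hG hK.1 hT.1, hU, ← hG.levelOutage_eq hK.1, hG.levelOutage_eq_gain hK.1]
  exact ⟨T, hL, ⟨hT, fun T' hT' => hout ▸ hK.le_worstOutage hG hT'⟩, hout⟩

lemma IsMinimaxOptimal.worstOutage_eq {T : Strategy M} (hT : G.IsMinimaxOptimal T) :
    G.worstOutage T = G.minimaxValue :=
  le_antisymm (le_iInf₂ fun T' hT' => hT.2 T' hT') (iInf₂_le T hT.1)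

lemma IsBestLevel.minimaxValue_eq {K : ℝ≥0} (hK : G.IsBestLevel K) (hG : G.Proper)
    [IsProbabilityMeasure G.law] : G.minimaxValue = 1 - ENNReal.ofReal (G.gain K) := by
  obtain ⟨T, -, hopt, hout⟩ := hK.exists_optimal hG
  rw [← hopt.worstOutage_eq, hout]

/-- The level of `T` is the jammer's own threshold `κ` against `T`, possibly different from `K`.
Optimality forces `gain κ = gain K` and a full packing at `κ`. -/
lemma IsBestLevel.of_isMinimaxOptimal {K : ℝ≥0} (hK : G.IsBestLevel K) (hG : G.Proper)
    [IsProbabilityMeasure G.law] {T : Strategy M} (hT : G.IsMinimaxOptimal T) :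
    G.avgPower T = G.txBudget ∧ ∃ L, G.IsBestLevel L ∧ G.IsLevelStrategy L T := by
  have hout : G.worstOutage T = 1 - ENNReal.ofReal (G.gain K) :=
    hT.worstOutage_eq.trans (hK.minimaxValue_eq hG)
  have hg1 : ENNReal.ofReal (G.gain K) ≤ 1 := by simpa using gain_le_one K
  have hlt : G.worstOutage T < 1 := by
    rw [hout]
    exact ENNReal.sub_lt_self ENNReal.one_ne_top one_ne_zero (by simpa using hK.2.1)
  obtain ⟨κ, hκ, he⟩ := hG.exists_levelFraction_eq hT.1 hlt
  have hle := hG.levelFraction_le_gain hκ hT.1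
  have hg : 1 - (G.worstOutage T).toReal = G.gain K := by
    rw [hout, ENNReal.toReal_sub_of_le hg1 ENNReal.one_ne_top, ENNReal.toReal_ofReal hK.2.1.le]
    simp
  have hgκ : G.gain κ = G.gain K := le_antisymm (hK.2.2 κ hκ) (by linarith)
  have hκbest : G.IsBestLevel κ := ⟨hκ, hgκ ▸ hK.2.1, fun L hL => hgκ ▸ hK.2.2 L hL⟩
  have hfull : ∫⁻ h, G.levelFraction κ T h ∂G.law = G.coverage κ := by
    have hpack := hG.isPacking_levelFraction hκ hT.1
    rw [← ENNReal.toReal_eq_toReal_iff' (hpack.lintegral_le.trans_lt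
      (lt_top_iff_ne_top.2 (coverage_ne_top κ))).ne (coverage_ne_top κ)]
    rw [hg, ← hgκ, gain] at he
    linarith
  obtain ⟨h1, h2⟩ := hG.isLevelStrategy_of_lintegral_eq hκ hκbest.2.2 hT.1 hfull
  exact ⟨h1, κ, hκbest, h2⟩

/-! ### Degenerate levels and the grid search -/

lemma worstOutage_eq_one_of_ae_eq_zero (hR : 0 < G.rate) [IsProbabilityMeasure G.law]
    {T : Strategy M} (hT : ∀ᵐ h ∂G.law, T h = 0) : G.worstOutage T = 1 := by
  refine le_antisymm (worstOutage_le_one T) ?_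
  have hJ : G.JamAdmissible 0 := ⟨measurable_const, by simp [avgPower]⟩
  refine le_trans ?_ (le_iSup₂ (f := fun J (_ : G.JamAdmissible J) => G.outage T J) 0 hJ)
  rw [outage, ← measure_univ (μ := G.law)]
  refine measure_mono_ae ?_
  filter_upwards [hT] with h hh _
  show G.mutualInfo h (T h) _ < G.rate
  rw [hh, mutualInfo_zero]
  exact hR

/-- Level 0 requires no power, so almost every frame is empty. A grid minimizer with outage below 1
is therefore positive, where the gain formula holds. -/
lemma Proper.levelOutage_zero (hG : G.Proper) [IsProbabilityMeasure G.law] :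
    1 ≤ G.levelOutage 0 := by
  refine le_iInf fun T => le_iInf₂ fun _ ⟨θ, hθ⟩ => ?_
  refine (worstOutage_eq_one_of_ae_eq_zero hG.rate_pos ?_).ge
  filter_upwards [hθ] with h hh
  rcases hh with ⟨h1, -⟩ | ⟨h1, -⟩
  · have : G.requiredTx 0 h = 0 := le_antisymm (iInf₂_le (0 : ℝ≥0) (by simp)) zero_le
    rw [this] at h1
    exact (frameAvg_eq_zero hG.card_pos).1 (by exact_mod_cast h1)
  · exact h1

lemma zero_isLevelStrategy (K : ℝ≥0) : G.IsLevelStrategy K 0 :=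
  ⟨0, Eventually.of_forall fun _ => Or.inr ⟨rfl, zero_le⟩⟩

lemma zero_txAdmissible : G.TxAdmissible 0 := ⟨measurable_const, by simp [avgPower]⟩

lemma levelOutage_le_one [IsProbabilityMeasure G.law] (K : ℝ≥0) : G.levelOutage K ≤ 1 :=
  (iInf_le_of_le 0 (iInf₂_le zero_txAdmissible (zero_isLevelStrategy K))).trans
    (worstOutage_le_one 0)

/-- Levels whose gain is close to the greatest gain are close to a level of greatest gain. -/
lemma Proper.exists_gain_threshold (hG : G.Proper) [IsProbabilityMeasure G.law] {K₀ Kmax ε : ℝ≥0}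
    (hK₀ : G.IsBestLevel K₀) (hε : 0 < ε) : ∃ w, 0 ≤ w ∧ w < G.gain K₀ ∧
      ∀ K, 0 < K → K ≤ Kmax → w < G.gain K → ∃ L, G.IsBestLevel L ∧ dist K L < ε := by
  -- The levels far from every best level. Those below `jamBudget` have nonpositive gain and may be
  -- dropped, which keeps `C` away from 0 and within the range of `continuousAt_gain`.
  set C : Set ℝ≥0 := Set.Icc G.jamBudget Kmax ∩ ⋂ L ∈ {L | G.IsBestLevel L}, {K | ε ≤ dist K L}
    with hC
  have hCmem : ∀ {K}, K ∈ C ↔ K ∈ Set.Icc G.jamBudget Kmax ∧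
      ∀ L, G.IsBestLevel L → (ε : ℝ) ≤ dist K L := by
    intro K
    simp [hC]
  have hCc : IsCompact C := isCompact_Icc.inter_right
    (isClosed_biInter fun L _ => isClosed_le continuous_const (continuous_id.dist continuous_const))
  have hfar : ∀ w, 0 ≤ w → (∀ K ∈ C, G.gain K ≤ w) → ∀ K, 0 < K → K ≤ Kmax → w < G.gain K →
      ∃ L, G.IsBestLevel L ∧ dist K L < ε := by
    intro w hw hCw K hK hKmax hlt
    by_contra! hno
    refine hlt.not_ge (hCw K (hCmem.2 ⟨⟨?_, hKmax⟩, hno⟩))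
    by_contra! hKJ
    exact (hw.trans_lt hlt).not_ge (gain_nonpos hK hKJ.le)
  rcases C.eq_empty_or_nonempty with h0 | hne
  · exact ⟨0, le_rfl, hK₀.2.1, hfar 0 le_rfl (by simp [h0])⟩
  obtain ⟨K₁, hK₁, hmax⟩ := hCc.exists_isMaxOn hne
    fun K hK => (hG.continuousAt_gain (hG.jamBudget_pos.trans_le
      (hCmem.1 hK).1.1)).continuousWithinAt
  have hK₁0 : 0 < K₁ := hG.jamBudget_pos.trans_le (hCmem.1 hK₁).1.1
  refine ⟨max (G.gain K₁) 0, le_max_right _ _, max_lt ?_ hK₀.2.1,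
    hfar _ (le_max_right _ _) fun K hK => (hmax hK).trans (le_max_left _ _)⟩
  -- If the maximum over `C` equalled the global one, `K₁` would be a best level at distance at
  -- least `ε` from itself.
  refine lt_of_le_of_ne (hK₀.2.2 K₁ hK₁0) fun heq => ?_
  have := (hCmem.1 hK₁).2 K₁ ⟨hK₁0, heq ▸ hK₀.2.1, fun L hL => heq ▸ hK₀.2.2 L hL⟩
  rw [dist_self] at this
  exact this.not_gt (by exact_mod_cast hε)

lemma IsBestLevel.exists_grid {K₀ : ℝ≥0} (hK₀ : G.IsBestLevel K₀) (hG : G.Proper)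
    [IsProbabilityMeasure G.law] {Kmax : ℝ≥0} (hmax : ∀ K, G.IsBestLevel K → K ≤ Kmax)
    {ε : ℝ≥0} (hε : 0 < ε) : ∃ δ : ℝ≥0, 0 < δ ∧
      ∀ grid : Finset ℝ≥0, (∀ x ∈ grid, x ≤ Kmax) →
        (∀ x : ℝ≥0, x ≤ Kmax → ∃ y ∈ grid, dist x y ≤ δ) →
        ∀ K ∈ grid, (∀ K' ∈ grid, G.levelOutage K ≤ G.levelOutage K') →
          G.levelOutage K ≤ G.minimaxValue + (ε : ℝ≥0∞) ∧
          ∃ L, G.IsBestLevel L ∧ dist K L ≤ ε := by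
  obtain ⟨w, hw0, hw, hclose⟩ := hG.exists_gain_threshold (Kmax := Kmax) hK₀ hε
  have hε' : (0 : ℝ) < ε := by exact_mod_cast hε
  -- A gain above `w` ensures closeness to a best level, a gain above `gain K₀ - ε` ensures an
  -- outage within `ε` of the value. A grid minimizer inherits both from a grid point near `K₀`.
  have hev : ∀ᶠ y in 𝓝 K₀, 0 < y ∧ max w (G.gain K₀ - ε) < G.gain y :=
    (lt_mem_nhds hK₀.1).and
      ((hG.continuousAt_gain hK₀.1).eventually_const_lt (max_lt hw (by linarith)))
  obtain ⟨r, hr, hball⟩ := Metric.eventually_nhds_iff.1 hev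
  refine ⟨⟨r / 2, by positivity⟩, by exact_mod_cast half_pos hr, ?_⟩
  intro grid hgrid hnet K hK hmin
  obtain ⟨y, hy, hdist⟩ := hnet K₀ (hmax K₀ hK₀)
  have hdist' : dist K₀ y ≤ r / 2 := hdist
  obtain ⟨hy0, hylt⟩ := hball (y := y) (by
    rw [dist_comm]
    linarith)
  have hle := hmin y hy
  rw [hG.levelOutage_eq_gain hy0] at hle
  have hypos : 0 < G.gain y := hw0.trans_lt ((le_max_left _ _).trans_lt hylt)
  have hy1 : ENNReal.ofReal (G.gain y) ≤ 1 := by simpa using gain_le_one y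
  have hKpos : 0 < K := by
    refine pos_of_ne_zero ?_
    rintro rfl
    refine (hG.levelOutage_zero.trans hle).not_gt ?_
    exact ENNReal.sub_lt_self ENNReal.one_ne_top one_ne_zero (by simpa using hypos)
  rw [hG.levelOutage_eq_gain hKpos] at hle
  have hgle : G.gain y ≤ G.gain K := by
    have h1 := (ENNReal.sub_le_sub_iff_left hy1 ENNReal.one_ne_top).1 hle
    exact (ENNReal.ofReal_le_ofReal_iff' |>.1 h1).resolve_right hypos.not_ge
  have hKlt := hylt.trans_le hgle
  refine ⟨?_, ?_⟩
  · rw [hG.levelOutage_eq_gain hKpos, hK₀.minimaxValue_eq hG, tsub_le_iff_right]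
    calc (1 : ℝ≥0∞) ≤ 1 - ENNReal.ofReal (G.gain K₀) + ENNReal.ofReal (G.gain K₀) :=
          le_tsub_add
      _ ≤ 1 - ENNReal.ofReal (G.gain K₀) + (ENNReal.ofReal (G.gain K) + ε) := by
          gcongr
          rw [← ENNReal.ofReal_coe_nnreal, ← ENNReal.ofReal_add
            (hypos.le.trans hgle) (NNReal.coe_nonneg ε)]
          refine ENNReal.ofReal_le_ofReal ?_
          have := (le_max_right w (G.gain K₀ - ε)).trans hKlt.le
          linarith
      _ = _ := by ring
  · obtain ⟨L, hL, hLd⟩ := hclose K hKpos (hgrid K hK) ((le_max_left _ _).trans_lt hKlt)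
    exact ⟨L, hL, hLd.le⟩

end Game

end SlowFading

/-! ### The theorem -/

theorem mainTheorem4 {M : ℕ} (hM : 0 < M) (G : SlowFading.Game M)
    [IsProbabilityMeasure G.law]
    (hdensity : G.law ≪ volume)
    (hnonneg : ∀ᵐ h ∂G.law, ∀ m, 0 ≤ h m)
    (hnoise : 0 < G.noise) (hrate : 0 < G.rate)
    (htx : 0 < G.txBudget) (hjam : 0 < G.jamBudget) :
    -- the outage probability caused by any admissible level strategy
    (∀ (K : ℝ≥0) (T : SlowFading.Strategy M), 0 < K → G.TxAdmissible T →
      G.IsLevelStrategy K T →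
        G.worstOutage T = 1 - (G.law {h | T h ≠ 0} - (G.jamBudget : ℝ≥0∞) / (K : ℝ≥0∞))) ∧
    ∃ Kmax : ℝ≥0,
      -- some level strategy with full average power is optimal
      (∃ (K : ℝ≥0) (T : SlowFading.Strategy M), 0 < K ∧ K ≤ Kmax ∧
        G.IsLevelStrategy K T ∧ G.avgPower T = (G.txBudget : ℝ≥0∞) ∧ G.IsMinimaxOptimal T) ∧
      -- unless outage is certain, every optimal strategy is of this kind
      (G.minimaxValue < 1 → ∀ T : SlowFading.Strategy M, G.IsMinimaxOptimal T →
        G.avgPower T = (G.txBudget : ℝ≥0∞) ∧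
          ∃ K : ℝ≥0, 0 < K ∧ K ≤ Kmax ∧ G.IsLevelStrategy K T) ∧
      -- the optimal level is found by exhaustive search on fine finite grids
      (∀ ε : ℝ≥0, 0 < ε → ∃ δ : ℝ≥0, 0 < δ ∧
        ∀ grid : Finset ℝ≥0, (∀ x ∈ grid, x ≤ Kmax) →
          (∀ x : ℝ≥0, x ≤ Kmax → ∃ y ∈ grid, dist x y ≤ δ) →
          ∀ K ∈ grid, (∀ K' ∈ grid, G.levelOutage K ≤ G.levelOutage K') →
            G.levelOutage K ≤ G.minimaxValue + (ε : ℝ≥0∞) ∧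
            ∃ Kopt : ℝ≥0, Kopt ≤ Kmax ∧ dist K Kopt ≤ ε ∧ G.IsOptimalLevel Kopt) := by
  have hG : G.Proper := ⟨hM, hdensity, hnonneg, hnoise, hrate, htx, hjam⟩
  refine ⟨fun K T hK hT hL => hL.worstOutage_eq hG hK hT.1, ?_⟩
  by_cases hv : G.minimaxValue < 1
  · obtain ⟨T₀, hT₀, hlt⟩ : ∃ T, G.TxAdmissible T ∧ G.worstOutage T < 1 := by
      simpa only [SlowFading.Game.minimaxValue, iInf_lt_iff, exists_prop] using hv
    obtain ⟨Kmax, ⟨K₀, hK₀⟩, hmax⟩ := hG.exists_isBestLevel hT₀ hlt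
    refine ⟨Kmax, ?_, fun _ T hT => ?_, fun ε hε => ?_⟩
    · obtain ⟨T, -, hopt, -⟩ := hK₀.exists_optimal hG
      obtain ⟨hpow, L, hL, hLT⟩ := hK₀.of_isMinimaxOptimal hG hopt
      exact ⟨L, T, hL.1, hmax L hL, hLT, hpow, hopt⟩
    · obtain ⟨hpow, L, hL, hLT⟩ := hK₀.of_isMinimaxOptimal hG hT
      exact ⟨hpow, L, hL.1, hmax L hL, hLT⟩
    · obtain ⟨δ, hδ, hgrid⟩ := hK₀.exists_grid hG hmax hε
      refine ⟨δ, hδ, fun grid h1 h2 K hK h3 => ?_⟩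
      obtain ⟨h4, L, hL, hd⟩ := hgrid grid h1 h2 K hK h3
      obtain ⟨T, hLT, hopt, -⟩ := hL.exists_optimal hG
      exact ⟨h4, L, hmax L hL, hd, T, hLT, hopt⟩
  -- If outage is certain, every admissible strategy is optimal, even the empty one, which has every
  -- level. Only full power needs care: at `K₀ + 1` the coverage is below 1, so serving all frames
  -- would exceed the budget, and the level strategy spends all of it.
  · have hone : ∀ T, G.TxAdmissible T → 1 ≤ G.worstOutage T := fun T hT =>
      (not_lt.1 hv).trans (iInf₂_le T hT)
    have hopt : ∀ T, G.TxAdmissible T → G.IsMinimaxOptimal T := fun T hT =>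
      ⟨hT, fun T' hT' => (SlowFading.Game.worstOutage_le_one T).trans (hone T' hT')⟩
    obtain ⟨K₀, hK₀⟩ := hG.exists_coverage_lt one_pos
    have hK : 0 < K₀ + 1 := by positivity
    obtain ⟨T, hT, hL, -, hpow⟩ := hG.exists_isLevelStrategy hK
    have hlt := SlowFading.Game.txBudget_lt_lintegral_requiredTx (hK₀ (K₀ + 1) (lt_add_one K₀))
    refine ⟨K₀ + 1, ⟨K₀ + 1, T, hK, le_rfl, hL, by rw [hpow, min_eq_left hlt.le], hopt T hT⟩,
      fun h => absurd h hv, fun ε _ => ⟨1, one_pos, fun grid h1 _ K hKg _ => ⟨?_, K, h1 K hKg, ?_, 0,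
        SlowFading.Game.zero_isLevelStrategy K, hopt 0 SlowFading.Game.zero_txAdmissible⟩⟩⟩
    · exact (SlowFading.Game.levelOutage_le_one K).trans ((not_lt.1 hv).trans le_self_add)
    · simp
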